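/- All graphs are finite, simple and undirected. For a graph $H$ and a positive integer $n$, let $ex_{\mathcal P}(n,H)$ denote the maximum number of edges of a planar graph on $n$ vertices that does not contain $H$ as a (not necessarily induced) subgraph. For a positive integer $k$, let $F_k = K_1 + P_{k+1}$ be the $k$-fan, that is, the graph obtained from the path $P_{k+1}$ on $k+1$ vertices by adding one new vertex adjacent to all vertices of the path. Theorem. Let $n,k$ be positive integers with $k\le 5$ and $n\ge k+2$. Then $ex_{\mathcal P}(n,F_k)=3n-6$ if and only if $(n,k)\in\{(6,4),(7,5),(8,5),(9,5),(10,5),(12,5)\}$. -/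

import Mathlib

/-- `IsPolygonalArc a b S`: the set `S` in the plane `ℝ × ℝ` is a simple polygonal arc with ends
`a ≠ b`. Either `S` is a nondegenerate straight line segment, or `S` is the union of a
nondegenerate straight line segment `[a, b]` and a simple polygonal arc from `b` to `c`,
these two meeting only in the point `b`. -/
inductive IsPolygonalArc : ℝ × ℝ → ℝ × ℝ → Set (ℝ × ℝ) → Prop
  | single (a b : ℝ × ℝ) : a ≠ b → IsPolygonalArc a b (segment ℝ a b)
  | cons (a b c : ℝ × ℝ) (S : Set (ℝ × ℝ)) : a ≠ b → IsPolygonalArc b c S →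
      segment ℝ a b ∩ S = {b} → IsPolygonalArc a c (segment ℝ a b ∪ S)

/-- A drawing of the simple graph `G` in the plane without crossings: distinct vertices are
distinct points, every edge is a simple polygonal arc between its two end vertices, and the
interior of (the arc of) an edge contains no vertex and no point of any other edge. -/
structure PlaneDrawing {V : Type*} (G : SimpleGraph V) where
  /-- The point representing a vertex. -/
  pt : V → ℝ × ℝ
  /-- The set of points of an edge (irrelevant for pairs that are not edges). -/
  arc : Sym2 V → Set (ℝ × ℝ)
  pt_injective : Function.Injective pt
  isPolygonalArc : ∀ u v : V, G.Adj u v → IsPolygonalArc (pt u) (pt v) (arc s(u, v))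
  mem_of_pt_mem_arc : ∀ e ∈ G.edgeSet, ∀ w : V, pt w ∈ arc e → w ∈ e
  eq_pt_of_mem_arc : ∀ e ∈ G.edgeSet, ∀ f ∈ G.edgeSet, e ≠ f →
    ∀ x ∈ arc e ∩ arc f, ∃ w : V, w ∈ e ∧ w ∈ f ∧ pt w = x

/-- A graph is planar if it can be drawn in the plane without crossings. -/
def IsPlanar {V : Type*} (G : SimpleGraph V) : Prop := Nonempty (PlaneDrawing G)

/-- The planar Turán number: the maximum number of edges of a planar graph on `n` vertices that
does not contain `H` as a (not necessarily induced) subgraph. If `H` has an edge, this maximum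
is attained, see `isGreatest_planarTuranNumber`. -/
noncomputable def planarTuranNumber (n : ℕ) {W : Type*} (H : SimpleGraph W) : ℕ :=
  sSup {m : ℕ | ∃ G : SimpleGraph (Fin n), IsPlanar G ∧ H.Free G ∧ G.edgeSet.ncard = m}

/-- The join of two graphs: the disjoint union together with all edges between the two parts. -/
def graphJoin {V W : Type*} (G : SimpleGraph V) (H : SimpleGraph W) : SimpleGraph (V ⊕ W) :=
  SimpleGraph.sum G H ⊔ completeBipartiteGraph V W

/-- The `k`-fan `K₁ + P_{k+1}`, where `P_{k+1}` is the path on `k + 1` vertices. -/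
def fanGraph (k : ℕ) : SimpleGraph (Fin 1 ⊕ Fin (k + 1)) :=
  graphJoin (⊤ : SimpleGraph (Fin 1)) (SimpleGraph.pathGraph (k + 1))

theorem isPlanar_bot (n : ℕ) : IsPlanar (⊥ : SimpleGraph (Fin n)) :=
  ⟨{ pt := fun i => ((i : ℕ), 0)
     arc := fun _ => ∅
     pt_injective := fun i j h => by
       have h1 : ((i : ℕ) : ℝ) = ((j : ℕ) : ℝ) := congrArg Prod.fst h
       exact Fin.ext (by exact_mod_cast h1)
     isPolygonalArc := fun _ _ h => absurd h (by simp)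
     mem_of_pt_mem_arc := fun _ h => absurd h (by simp)
     eq_pt_of_mem_arc := fun _ h => absurd h (by simp) }⟩

theorem isGreatest_planarTuranNumber (n : ℕ) {W : Type*} (H : SimpleGraph W) (hH : H ≠ ⊥) :
    IsGreatest {m : ℕ | ∃ G : SimpleGraph (Fin n), IsPlanar G ∧ H.Free G ∧ G.edgeSet.ncard = m}
      (planarTuranNumber n H) := by
  have hb : BddAbove
      {m : ℕ | ∃ G : SimpleGraph (Fin n), IsPlanar G ∧ H.Free G ∧ G.edgeSet.ncard = m} := by
    refine ⟨Nat.card (Sym2 (Fin n)), ?_⟩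
    rintro m ⟨G, -, -, rfl⟩
    exact Set.ncard_le_card _
  refine ⟨Nat.sSup_mem ⟨_, ⊥, isPlanar_bot n, SimpleGraph.free_bot hH, rfl⟩ hb, ?_⟩
  exact fun m hm => le_csSup hb hm

/-! A planar graph on n ≥ 3 vertices has at most 3n - 6 edges, and one attaining this bound is a
triangulation. In a triangulation consecutive neighbours around a vertex are adjacent, so a vertex
of degree above k is the centre of a k-fan; conversely, a graph of maximum degree at most k contains
no k-fan. Hence the value 3n - 6 is attained exactly when some n-vertex triangulation has maximum
degree at most k. The degree sum then gives 6n - 12 ≤ kn, which with n ≥ k + 2 and k ≤ 5 leaves only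
the listed pairs and (11, 5). In the last case one vertex would have degree 4 and all others degree
5, which `IsNext.not_degree_four_five` refutes. The listed pairs are realised by explicit straight
line drawings.

The main work is the edge bound with its equality case, obtained without the Jordan curve theorem.
To each arc belongs the angle under which it is seen from a point x: off the arc it is continuous,
its local changes depend only on the two ends, and it jumps by 2π across the arc. For a flow y on
the edges (zero net flow at each vertex), the sum of these angles weighted by y is therefore locally
constant off the drawing, and its jump across e is 2π y(e). Its values beside the darts are constant
along the orbits of the face permutation (`PlaneDrawing.exists_isPlanarRotation`). So every flow is
a coboundary of a function on faces, and counting dimensions gives E + 2 ≤ F + V. Faces have at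
least three darts when all degrees are at least 2; vertices of smaller degree are removed by
induction. -/

/-! ### Directions and one-sided values at a point -/

section Germs
open Filter Topology Set

/-- `g` takes the value `y` just counterclockwise of the ray from `p` in direction `α`, near `p`. -/
def LeftGerm (g : ℂ → ℝ) (p : ℂ) (α y : ℝ) : Prop :=
  ∀ᶠ r in 𝓝[>] (0 : ℝ), ∀ᶠ t in 𝓝[>] α, g (circleMap p r t) = y

/-- `g` takes the value `y` just clockwise of the ray from `p` in direction `α`, near `p`. -/
def RightGerm (g : ℂ → ℝ) (p : ℂ) (α y : ℝ) : Prop :=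
  ∀ᶠ r in 𝓝[>] (0 : ℝ), ∀ᶠ t in 𝓝[<] α, g (circleMap p r t) = y

/-- Near `p`, the set `S` is a straight radius in direction `α`. -/
def RadialAt (S : Set ℂ) (p : ℂ) (α : ℝ) : Prop :=
  ∀ᶠ r in 𝓝[>] (0 : ℝ), ∀ t : ℝ, circleMap p r t ∈ S ↔ (t : Real.Angle) = α

/-- `g` is locally constant off `K`. -/
def LocConstOff (g : ℂ → ℝ) (K : Set ℂ) : Prop :=
  ∀ x ∉ K, ∀ᶠ x' in 𝓝 x, g x' = g x

theorem circleMap_congr_angle {p : ℂ} {r s t : ℝ} (h : (s : Real.Angle) = t) :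
    circleMap p r s = circleMap p r t := by
  obtain ⟨k, hk⟩ := Real.Angle.angle_eq_iff_two_pi_dvd_sub.1 h
  have : s = t + k * (2 * Real.pi) := by linarith
  rw [this]
  exact (periodic_circleMap p r).int_mul k t

theorem angle_eq_of_circleMap_eq {p : ℂ} {r s t : ℝ} (hr : 0 < r)
    (h : circleMap p r s = circleMap p r t) : (s : Real.Angle) = t := by
  obtain ⟨n, hn⟩ := (circleMap_eq_circleMap_iff p hr.ne').1 h
  rw [Real.Angle.angle_eq_iff_two_pi_dvd_sub]
  refine ⟨n, ?_⟩
  have := congrArg Complex.im hn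
  simp at this
  linarith

theorem LeftGerm.unique {g : ℂ → ℝ} {p : ℂ} {α y y' : ℝ} (h : LeftGerm g p α y)
    (h' : LeftGerm g p α y') : y = y' := by
  obtain ⟨r, h1, h2⟩ := (h.and h').exists
  obtain ⟨t, h3, h4⟩ := (h1.and h2).exists
  exact h3.symm.trans h4

theorem RightGerm.unique {g : ℂ → ℝ} {p : ℂ} {α y y' : ℝ} (h : RightGerm g p α y)
    (h' : RightGerm g p α y') : y = y' := by
  obtain ⟨r, h1, h2⟩ := (h.and h').exists
  obtain ⟨t, h3, h4⟩ := (h1.and h2).exists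
  exact h3.symm.trans h4

theorem LeftGerm.congr_angle {g : ℂ → ℝ} {p : ℂ} {α β y : ℝ} (h : LeftGerm g p α y)
    (hab : (α : Real.Angle) = β) : LeftGerm g p β y := by
  obtain ⟨k, hk⟩ := Real.Angle.angle_eq_iff_two_pi_dvd_sub.1 hab
  refine Eventually.mono h fun r hr => ?_
  have ht : Tendsto (fun t : ℝ => t + (α - β)) (𝓝[>] β) (𝓝[>] α) := by
    refine tendsto_nhdsWithin_iff.2 ⟨?_, ?_⟩
    · have : Tendsto (fun t : ℝ => t + (α - β)) (𝓝 β) (𝓝 (β + (α - β))) :=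
        (continuous_id.add continuous_const).tendsto β
      rw [add_sub_cancel] at this
      exact this.mono_left nhdsWithin_le_nhds
    · filter_upwards [self_mem_nhdsWithin] with t ht
      simp only [mem_Ioi] at *; linarith
  refine (ht.eventually hr).mono fun t h1 => ?_
  rw [← h1]
  refine congrArg g (circleMap_congr_angle ?_)
  rw [Real.Angle.angle_eq_iff_two_pi_dvd_sub]
  exact ⟨-k, by push_cast; linarith⟩

theorem RightGerm.congr_angle {g : ℂ → ℝ} {p : ℂ} {α β y : ℝ} (h : RightGerm g p α y)
    (hab : (α : Real.Angle) = β) : RightGerm g p β y := by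
  obtain ⟨k, hk⟩ := Real.Angle.angle_eq_iff_two_pi_dvd_sub.1 hab
  refine Eventually.mono h fun r hr => ?_
  have ht : Tendsto (fun t : ℝ => t + (α - β)) (𝓝[<] β) (𝓝[<] α) := by
    refine tendsto_nhdsWithin_iff.2 ⟨?_, ?_⟩
    · have : Tendsto (fun t : ℝ => t + (α - β)) (𝓝 β) (𝓝 (β + (α - β))) :=
        (continuous_id.add continuous_const).tendsto β
      rw [add_sub_cancel] at this
      exact this.mono_left nhdsWithin_le_nhds
    · filter_upwards [self_mem_nhdsWithin] with t ht
      simp only [mem_Iio] at *; linarith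
  refine (ht.eventually hr).mono fun t h1 => ?_
  rw [← h1]
  refine congrArg g (circleMap_congr_angle ?_)
  rw [Real.Angle.angle_eq_iff_two_pi_dvd_sub]
  exact ⟨-k, by push_cast; linarith⟩

theorem RadialAt.unique {S : Set ℂ} {p : ℂ} {α β : ℝ} (h : RadialAt S p α)
    (h' : RadialAt S p β) : (α : Real.Angle) = β := by
  obtain ⟨r, h1, h2⟩ := (h.and h').exists
  exact (h2 α).1 ((h1 α).2 rfl)

theorem RadialAt.congr_angle {S : Set ℂ} {p : ℂ} {α β : ℝ} (h : RadialAt S p α)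
    (hab : (α : Real.Angle) = β) : RadialAt S p β :=
  Eventually.mono h fun r hr t => by rw [hr t, hab]

theorem eventually_forall_circleMap {p : ℂ} {P : ℂ → Prop} (h : ∀ᶠ x in 𝓝 p, P x) :
    ∀ᶠ r in 𝓝[>] (0 : ℝ), ∀ t : ℝ, P (circleMap p r t) := by
  obtain ⟨ε, hε, h⟩ := Metric.eventually_nhds_iff.1 h
  filter_upwards [Ioo_mem_nhdsGT hε] with r hr t
  refine h ?_
  rw [dist_eq_norm, circleMap_sub_center, norm_circleMap_zero, abs_of_pos hr.1]
  exact hr.2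

theorem RadialAt.congr {S T : Set ℂ} {p : ℂ} {α : ℝ} (h : RadialAt S p α)
    (hST : ∀ᶠ x in 𝓝 p, x ∈ S ↔ x ∈ T) : RadialAt T p α := by
  filter_upwards [h, eventually_forall_circleMap hST] with r h1 h2 t
  rw [← h2, h1]

theorem LocConstOff.eq_of_isPreconnected {g : ℂ → ℝ} {K s : Set ℂ} (hg : LocConstOff g K)
    (hs : IsPreconnected s) (hsK : ∀ x ∈ s, x ∉ K) {x y : ℂ} (hx : x ∈ s) (hy : y ∈ s) :
    g x = g y := by
  refine hs.induction₂ (fun x y => g x = g y) (fun x hx => ?_) (fun _ _ _ _ _ _ h h' => h.trans h')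
    (fun _ _ _ _ h => h.symm) hx hy
  exact nhdsWithin_le_nhds ((hg x (hsK x hx)).mono fun _ h => h.symm)

theorem LocConstOff.exists_germ {g : ℂ → ℝ} {K : Set ℂ} (hg : LocConstOff g K) {p : ℂ} {α β : ℝ}
    (hab : α < β) (h : ∀ᶠ r in 𝓝[>] (0 : ℝ), ∀ t ∈ Ioo α β, circleMap p r t ∉ K) :
    ∃ y, LeftGerm g p α y ∧ RightGerm g p β y := by
  obtain ⟨ρ, hρ, h⟩ := mem_nhdsGT_iff_exists_Ioo_subset.1 h
  have hρ' : (0 : ℝ) < ρ := hρ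
  set s : Set ℂ := (fun q : ℝ × ℝ => circleMap p q.1 q.2) '' (Ioo 0 ρ ×ˢ Ioo α β) with hs
  have hpre : IsPreconnected s := by
    refine (isPreconnected_Ioo.prod isPreconnected_Ioo).image _ (Continuous.continuousOn ?_)
    unfold circleMap
    fun_prop
  have hsK : ∀ x ∈ s, x ∉ K := by
    rintro x ⟨⟨r, t⟩, ⟨hr, ht⟩, rfl⟩
    exact h hr t ht
  have h0 : circleMap p (ρ / 2) ((α + β) / 2) ∈ s :=
    ⟨(ρ / 2, (α + β) / 2), ⟨⟨by linarith, by linarith⟩, ⟨by linarith, by linarith⟩⟩, rfl⟩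
  refine ⟨g (circleMap p (ρ / 2) ((α + β) / 2)), ?_, ?_⟩
  · filter_upwards [Ioo_mem_nhdsGT hρ'] with r hr
    filter_upwards [Ioo_mem_nhdsGT hab] with t ht
    exact hg.eq_of_isPreconnected hpre hsK ⟨(r, t), ⟨hr, ht⟩, rfl⟩ h0
  · filter_upwards [Ioo_mem_nhdsGT hρ'] with r hr
    filter_upwards [Ioo_mem_nhdsLT hab] with t ht
    exact hg.eq_of_isPreconnected hpre hsK ⟨(r, t), ⟨hr, ht⟩, rfl⟩ h0

/-! ### Segments and polygonal arcs in polar coordinates -/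

theorem exists_eq_circleMap {a b : ℂ} (hab : a ≠ b) :
    ∃ R > 0, ∃ α : ℝ, b = circleMap a R α := by
  refine ⟨‖b - a‖, norm_pos_iff.2 (sub_ne_zero.2 hab.symm), (b - a).arg, ?_⟩
  simp [circleMap]

theorem circleMap_mem_segment {a : ℂ} {R α r : ℝ} (hr0 : 0 ≤ r) (hr : r ≤ R) (hR : 0 < R) :
    circleMap a r α ∈ segment ℝ a (circleMap a R α) := by
  rw [segment_eq_image']
  refine ⟨r / R, ⟨by positivity, (div_le_one hR).2 hr⟩, ?_⟩
  simp only [circleMap, add_sub_cancel_left, Complex.real_smul, Complex.ofReal_div]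
  have : (R : ℂ) ≠ 0 := by exact_mod_cast hR.ne'
  field_simp

theorem circleMap_mem_segment_iff {a : ℂ} {R α r t : ℝ} (hr0 : 0 < r) (hr : r ≤ R) :
    circleMap a r t ∈ segment ℝ a (circleMap a R α) ↔ (t : Real.Angle) = α := by
  have hR : 0 < R := hr0.trans_le hr
  constructor
  · intro h
    rw [segment_eq_image'] at h
    obtain ⟨s, ⟨hs0, hs1⟩, hs⟩ := h
    have h1 : circleMap a r t = circleMap a (s * R) α := by
      rw [← hs]; simp [circleMap]; ring
    have h2 : r = s * R := by
      have := congrArg (fun x => ‖x - a‖) h1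
      simpa [circleMap_sub_center, abs_of_pos hr0, abs_of_pos hR, abs_of_nonneg hs0] using this
    rw [← h2] at h1
    exact angle_eq_of_circleMap_eq hr0 h1
  · intro h
    rw [circleMap_congr_angle h]
    exact circleMap_mem_segment hr0.le hr hR

theorem radialAt_segment {a : ℂ} {R α : ℝ} (hR : 0 < R) :
    RadialAt (segment ℝ a (circleMap a R α)) a α := by
  filter_upwards [Ioo_mem_nhdsGT hR] with r hr t
  exact circleMap_mem_segment_iff hr.1 hr.2.le

theorem isClosed_segment (a b : ℂ) : IsClosed (segment ℝ a b) := by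
  rw [segment_eq_image']
  exact (isCompact_Icc.image (by fun_prop)).isClosed

/-- Simple polygonal arcs in the complex plane. -/
inductive IsPolyArc : ℂ → ℂ → Set ℂ → Prop
  | single (a b : ℂ) : a ≠ b → IsPolyArc a b (segment ℝ a b)
  | cons (a b c : ℂ) (S : Set ℂ) : a ≠ b → IsPolyArc b c S →
      segment ℝ a b ∩ S = {b} → IsPolyArc a c (segment ℝ a b ∪ S)

theorem IsPolygonalArc.image {a b : ℝ × ℝ} {S : Set (ℝ × ℝ)} (h : IsPolygonalArc a b S) :
    IsPolyArc (Complex.equivRealProdCLM.symm a) (Complex.equivRealProdCLM.symm b)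
      (Complex.equivRealProdCLM.symm '' S) := by
  have hseg : ∀ a b : ℝ × ℝ, Complex.equivRealProdCLM.symm '' segment ℝ a b =
      segment ℝ (Complex.equivRealProdCLM.symm a) (Complex.equivRealProdCLM.symm b) := fun a b =>
    image_segment ℝ
      (Complex.equivRealProdCLM.symm : (ℝ × ℝ) →L[ℝ] ℂ).toLinearMap.toAffineMap a b
  have hinj := Complex.equivRealProdCLM.symm.injective
  induction h with
  | single a b h => rw [hseg]; exact .single _ _ (hinj.ne h)
  | cons a b c S h _ hS ih =>
    rw [image_union, hseg]
    refine .cons _ _ _ _ (hinj.ne h) ih ?_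
    rw [← hseg, ← image_inter hinj, hS, image_singleton]

namespace IsPolyArc
variable {a c : ℂ} {S : Set ℂ}

theorem isClosed (h : IsPolyArc a c S) : IsClosed S := by
  induction h with
  | single a b _ => exact isClosed_segment a b
  | cons a b c S _ _ _ ih => exact (isClosed_segment a b).union ih

theorem left_mem (h : IsPolyArc a c S) : a ∈ S := by
  cases h with
  | single => exact left_mem_segment ℝ _ _
  | cons => exact Or.inl (left_mem_segment ℝ _ _)

theorem right_mem (h : IsPolyArc a c S) : c ∈ S := by
  induction h with
  | single => exact right_mem_segment ℝ _ _
  | cons _ _ _ _ _ _ _ ih => exact Or.inr ih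

theorem ne (h : IsPolyArc a c S) : a ≠ c := by
  cases h with
  | single _ _ h => exact h
  | cons _ b _ S h hS hi =>
    rintro rfl
    have : a ∈ segment ℝ a b ∩ S := ⟨left_mem_segment ℝ _ _, hS.right_mem⟩
    rw [hi] at this
    exact h this

theorem exists_radialAt_left (h : IsPolyArc a c S) : ∃ α, RadialAt S a α := by
  cases h with
  | single _ _ h =>
    obtain ⟨R, hR, α, rfl⟩ := exists_eq_circleMap h
    exact ⟨α, radialAt_segment hR⟩
  | cons _ b _ S h hS hi =>
    obtain ⟨R, hR, α, hb⟩ := exists_eq_circleMap h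
    refine ⟨α, (hb ▸ radialAt_segment hR).congr (T := segment ℝ a b ∪ S) ?_⟩
    have haS : a ∉ S := fun ha => h (by
      have : a ∈ segment ℝ a b ∩ S := ⟨left_mem_segment ℝ _ _, ha⟩
      rwa [hi] at this)
    filter_upwards [hS.isClosed.isOpen_compl.mem_nhds haS] with x hx
    simp only [mem_union]
    exact ⟨Or.inl, fun h => h.resolve_right hx⟩

end IsPolyArc

/-! ### Following one side of an arc from end to end -/

theorem tendsto_circleMap_gt_halfPlane {a : ℂ} {α r : ℝ} (hr : 0 < r) :
    Tendsto (circleMap a r) (𝓝[>] α)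
      (𝓝[{x | 0 < ((x - a) * Complex.exp (-(α * Complex.I))).im}] (circleMap a r α)) := by
  refine tendsto_nhdsWithin_iff.2 ⟨?_, ?_⟩
  · exact ((continuous_circleMap a r).tendsto α).mono_left nhdsWithin_le_nhds
  · have : α < α + Real.pi := by linarith [Real.pi_pos]
    filter_upwards [Ioo_mem_nhdsGT this] with t ht
    have h1 : (circleMap a r t - a) * Complex.exp (-(α * Complex.I))
        = r * Complex.exp ((t - α : ℝ) * Complex.I) := by
      rw [circleMap_sub_center, circleMap_zero, mul_assoc, ← Complex.exp_add]
      push_cast; ring_nf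
    simp only [h1]
    rw [Complex.im_ofReal_mul, Complex.exp_ofReal_mul_I_im]
    exact mul_pos hr (Real.sin_pos_of_pos_of_lt_pi (by linarith [ht.1]) (by linarith [ht.2]))

theorem circleMap_add_pi (a : ℂ) (R r α : ℝ) :
    circleMap (circleMap a R α) r (α + Real.pi) = circleMap a (R - r) α := by
  simp only [circleMap, Complex.ofReal_add, add_mul, Complex.exp_add, Complex.exp_pi_mul_I,
    Complex.ofReal_sub]
  ring

theorem tendsto_circleMap_lt_halfPlane {a : ℂ} {R α r : ℝ} (hr : 0 < r) :
    Tendsto (circleMap (circleMap a R α) r) (𝓝[<] (α + Real.pi))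
      (𝓝[{x | 0 < ((x - a) * Complex.exp (-(α * Complex.I))).im}] (circleMap a (R - r) α)) := by
  rw [← circleMap_add_pi]
  refine tendsto_nhdsWithin_iff.2 ⟨?_, ?_⟩
  · exact ((continuous_circleMap _ r).tendsto _).mono_left nhdsWithin_le_nhds
  · have : α < α + Real.pi := by linarith [Real.pi_pos]
    filter_upwards [Ioo_mem_nhdsLT this] with t ht
    have h1 : (circleMap (circleMap a R α) r t - a) * Complex.exp (-(α * Complex.I))
        = R + r * Complex.exp ((t - α : ℝ) * Complex.I) := by
      have h2 : Complex.exp (α * Complex.I) * Complex.exp (-(α * Complex.I)) = 1 := by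
        rw [← Complex.exp_add]; simp
      have h3 : Complex.exp ((t - α : ℝ) * Complex.I)
          = Complex.exp (t * Complex.I) * Complex.exp (-(α * Complex.I)) := by
        rw [← Complex.exp_add]; push_cast; ring_nf
      rw [h3]; simp only [circleMap]
      linear_combination (R : ℂ) * h2
    simp only [h1]
    rw [Complex.add_im, Complex.ofReal_im, zero_add, Complex.im_ofReal_mul,
      Complex.exp_ofReal_mul_I_im]
    exact mul_pos hr (Real.sin_pos_of_pos_of_lt_pi (by linarith [ht.1]) (by linarith [ht.2]))

theorem segment_disjoint_halfPlane {a x : ℂ} {R α : ℝ}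
    (hx : x ∈ segment ℝ a (circleMap a R α)) :
    ((x - a) * Complex.exp (-(α * Complex.I))).im = 0 := by
  rw [segment_eq_image'] at hx
  obtain ⟨s, -, rfl⟩ := hx
  have h2 : Complex.exp (α * Complex.I) * Complex.exp (-(α * Complex.I)) = 1 := by
    rw [← Complex.exp_add]; simp
  have : (a + s • (circleMap a R α - a) - a) * Complex.exp (-(α * Complex.I)) = (s * R : ℝ) := by
    simp only [circleMap, add_sub_cancel_left, Complex.real_smul]
    push_cast
    linear_combination (s * R : ℂ) * h2
  rw [this, Complex.ofReal_im]

/-- Small half-discs to the left of the open segment avoid `K`, so the value of `g` there cannot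
change along the segment. Seen from the far end, in direction `α + π`, the same side is the right
one. -/
theorem rightGerm_of_leftGerm_segment {g : ℂ → ℝ} {K : Set ℂ} {a : ℂ} {R α y : ℝ} (hR : 0 < R)
    (hg : LocConstOff g K)
    (hK : ∀ x ∈ segment ℝ a (circleMap a R α), x ≠ a → x ≠ circleMap a R α →
      ∀ᶠ x' in 𝓝 x, x' ∈ K → x' ∈ segment ℝ a (circleMap a R α))
    (h : LeftGerm g a α y) : RightGerm g (circleMap a R α) (α + Real.pi) y := by
  set H : Set ℂ := {x | 0 < ((x - a) * Complex.exp (-(α * Complex.I))).im} with hH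
  have hconv : Convex ℝ H := by
    have : H = (fun x => x * Complex.exp (-(α * Complex.I))) ⁻¹'
        {z | (a * Complex.exp (-(α * Complex.I))).im < z.im} := by
      ext x; simp [hH, sub_mul]
    rw [this]
    exact (convex_halfSpace_im_gt _).is_linear_preimage
      (IsLinearMap.mk (fun x y => by ring) fun c x => by simp [mul_assoc])
  -- `P r y`: beside the point at distance `r` along the segment, on the left, `g` equals `y`. This
  -- is locally constant in `r`, hence constant on the interval `(0, R)`.
  let P : ℝ → ℝ → Prop := fun r y => ∀ᶠ x in 𝓝[H] (circleMap a r α), g x = y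
  have huniq : ∀ r > 0, ∀ y y', P r y → P r y' → y = y' := fun r hr y y' h1 h2 => by
    obtain ⟨t, h3, h4⟩ := ((tendsto_circleMap_gt_halfPlane hr).eventually (h1.and h2)).exists
    exact h3.symm.trans h4
  have hloc : ∀ r ∈ Ioo 0 R, ∃ y, ∀ᶠ r' in 𝓝 r, P r' y := fun r hr => by
    have hne1 : circleMap a r α ≠ a := by
      rw [Ne, circleMap_eq_center_iff]; exact hr.1.ne'
    have hne2 : circleMap a r α ≠ circleMap a R α := fun h => by
      have := congrArg (fun x => ‖x - a‖) h
      simp [circleMap_sub_center, abs_of_pos hr.1, abs_of_pos hR] at this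
      linarith [hr.2]
    obtain ⟨ε, hε, hball⟩ := Metric.eventually_nhds_iff_ball.1
      (hK _ (circleMap_mem_segment hr.1.le hr.2.le hR) hne1 hne2)
    have hpre : IsPreconnected (Metric.ball (circleMap a r α) ε ∩ H) :=
      ((convex_ball _ _).inter hconv).isPreconnected
    have hnK : ∀ x ∈ Metric.ball (circleMap a r α) ε ∩ H, x ∉ K := fun x hx hxK => by
      have h1 := segment_disjoint_halfPlane (hball x hx.1 hxK)
      exact hx.2.ne' h1
    obtain ⟨y, hy⟩ : ∃ y, ∀ x ∈ Metric.ball (circleMap a r α) ε ∩ H, g x = y := by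
      rcases (Metric.ball (circleMap a r α) ε ∩ H).eq_empty_or_nonempty with h0 | ⟨x0, h0⟩
      · exact ⟨0, by simp [h0]⟩
      · exact ⟨g x0, fun x hx => hg.eq_of_isPreconnected hpre hnK hx h0⟩
    refine ⟨y, ?_⟩
    have hcont : Continuous fun r' : ℝ => circleMap a r' α := by unfold circleMap; fun_prop
    filter_upwards [hcont.continuousAt.preimage_mem_nhds (Metric.ball_mem_nhds _ hε)] with r' hr'
    filter_upwards [self_mem_nhdsWithin,
      nhdsWithin_le_nhds (Metric.isOpen_ball.mem_nhds hr')] with x h1 h2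
    exact hy x ⟨h2, h1⟩
  have hall : ∀ r ∈ Ioo 0 R, ∀ r' ∈ Ioo 0 R, ∀ y, P r y ↔ P r' y := fun r hr r' hr' => by
    refine isPreconnected_Ioo.induction₂ (fun r r' => ∀ y, P r y ↔ P r' y) (fun r hr => ?_)
      (fun _ _ _ _ _ _ h h' y => (h y).trans (h' y)) (fun _ _ _ _ h y => (h y).symm) hr hr'
    obtain ⟨y0, hy0⟩ := hloc r hr
    filter_upwards [self_mem_nhdsWithin, nhdsWithin_le_nhds hy0] with r' hr' h1 y
    exact ⟨fun h => huniq r hr.1 _ _ hy0.self_of_nhds h ▸ h1,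
      fun h => huniq r' hr'.1 _ _ h1 h ▸ hy0.self_of_nhds⟩
  have hy : ∀ r ∈ Ioo 0 R, P r y := by
    obtain ⟨r, hr, hrR⟩ := (h.and (Ioo_mem_nhdsGT hR)).exists
    obtain ⟨y0, hy0⟩ := hloc r hrR
    have h1 : P r y0 := hy0.self_of_nhds
    obtain ⟨t, h3, h4⟩ := (((tendsto_circleMap_gt_halfPlane hrR.1).eventually h1).and hr).exists
    have : P r y := (h3.symm.trans h4) ▸ h1
    exact fun r' hr' => (hall r hrR r' hr' y).1 this
  filter_upwards [Ioo_mem_nhdsGT hR] with r hr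
  exact (tendsto_circleMap_lt_halfPlane hr.1).eventually
    (hy (R - r) ⟨by linarith [hr.2], by linarith [hr.1]⟩)

theorem exists_angle_rep (α β : ℝ) :
    ∃ α' : ℝ, (α' : Real.Angle) = α ∧ α' < β ∧ β ≤ α' + 2 * Real.pi := by
  refine ⟨toIcoMod Real.two_pi_pos (β - 2 * Real.pi) α, Real.Angle.coe_toIcoMod _ _, ?_, ?_⟩
  · have := toIcoMod_lt_right Real.two_pi_pos (β - 2 * Real.pi) α; linarith
  · have := left_le_toIcoMod Real.two_pi_pos (β - 2 * Real.pi) α; linarith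

theorem angle_ne_of_lt {s t : ℝ} (h : s < t) (h' : t < s + 2 * Real.pi) :
    (t : Real.Angle) ≠ s := fun he => by
  obtain ⟨k, hk⟩ := Real.Angle.angle_eq_iff_two_pi_dvd_sub.1 he
  have hpi := Real.pi_pos
  have h0 : (0 : ℝ) < k := by
    by_contra! h0; nlinarith
  have h1 : (k : ℝ) < 1 := by
    by_contra! h0; nlinarith
  have h2 : (0 : ℤ) < k := by exact_mod_cast h0
  have h3 : k < (1 : ℤ) := by exact_mod_cast h1
  omega

/-- Induction on the segments. At a corner, the sector running counterclockwise from the outgoing to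
the backward direction avoids `K` near the corner, so the value passes from the end of one segment
to the start of the next. -/
theorem IsPolyArc.rightGerm_of_leftGerm {a c : ℂ} {S : Set ℂ} (h : IsPolyArc a c S) {g : ℂ → ℝ}
    {K : Set ℂ} (hg : LocConstOff g K)
    (hK : ∀ x ∈ S, x ≠ a → x ≠ c → ∀ᶠ x' in 𝓝 x, x' ∈ K → x' ∈ S) {α β y : ℝ}
    (hα : RadialAt S a α) (hβ : RadialAt S c β) (hy : LeftGerm g a α y) : RightGerm g c β y := by
  induction h generalizing α with
  | single a b hab =>
    obtain ⟨R, hR, γ, rfl⟩ := exists_eq_circleMap hab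
    have h1 : (α : Real.Angle) = γ := hα.unique (radialAt_segment hR)
    have h2 : RadialAt (segment ℝ a (circleMap a R γ)) (circleMap a R γ) (γ + Real.pi) := by
      have := radialAt_segment (a := circleMap a R γ) (α := γ + Real.pi) hR
      rwa [circleMap_add_pi, sub_self, circleMap_zero_radius, Function.const_apply,
        segment_symm] at this
    exact (rightGerm_of_leftGerm_segment hR hg hK (hy.congr_angle h1)).congr_angle (h2.unique hβ)
  | cons a b c S hab hS hi ih =>
    obtain ⟨R, hR, γ, rfl⟩ := exists_eq_circleMap hab
    set b := circleMap a R γ with hb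
    have haS : a ∉ S := fun ha => hab (by
      have : a ∈ segment ℝ a b ∩ S := ⟨left_mem_segment ℝ _ _, ha⟩
      rwa [hi] at this)
    have hcseg : c ∉ segment ℝ a b := fun hc => hS.ne (by
      have : c ∈ segment ℝ a b ∩ S := ⟨hc, hS.right_mem⟩
      rw [hi] at this
      exact this.symm)
    have hseg := isClosed_segment a b
    have hSc := hS.isClosed
    have h1 : (α : Real.Angle) = γ := by
      refine (hα.congr ?_).unique (radialAt_segment hR)
      filter_upwards [hSc.isOpen_compl.mem_nhds haS] with x hx
      exact ⟨fun h => h.resolve_right hx, Or.inl⟩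
    have h2 : RightGerm g b (γ + Real.pi) y := by
      refine rightGerm_of_leftGerm_segment hR hg (fun x hx hxa hxb => ?_) (hy.congr_angle h1)
      have hxS : x ∉ S := fun h => hxb (by
        have : x ∈ segment ℝ a b ∩ S := ⟨hx, h⟩
        rwa [hi] at this)
      have hxc : x ≠ c := by rintro rfl; exact hcseg hx
      filter_upwards [hK x (Or.inl hx) hxa hxc, hSc.isOpen_compl.mem_nhds hxS] with x' h3 h4 h5
      exact (h3 h5).resolve_right h4
    have h3 : RadialAt (segment ℝ a b) b (γ + Real.pi) := by
      have := radialAt_segment (a := b) (α := γ + Real.pi) hR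
      rwa [hb, circleMap_add_pi, sub_self, circleMap_zero_radius, Function.const_apply, ← hb,
        segment_symm] at this
    obtain ⟨δ, hδ⟩ := hS.exists_radialAt_left
    -- The outgoing direction is represented within one turn below the backward direction, so the
    -- sector is an honest interval of angles.
    obtain ⟨δ', hδ1, hδ2, hδ3⟩ := exists_angle_rep δ (γ + Real.pi)
    obtain ⟨y', hy1, hy2⟩ := hg.exists_germ (p := b) hδ2 (by
      filter_upwards [h3, hδ, eventually_forall_circleMap
        (hK b (Or.inl (right_mem_segment ℝ _ _)) hab.symm hS.ne)] with r h4 h5 h6 t ht htK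
      rcases h6 t htK with h7 | h7
      · refine angle_ne_of_lt ht.2 ?_ ((h4 t).1 h7).symm
        linarith [ht.1]
      · rw [h5, ← hδ1] at h7
        exact angle_ne_of_lt ht.1 (by linarith [ht.2]) h7)
    obtain rfl := h2.unique hy2
    refine ih (fun x hx hxb hxc => ?_) hδ (hβ.congr ?_) (hy1.congr_angle hδ1)
    · have hxseg : x ∉ segment ℝ a b := fun h => hxb (by
        have : x ∈ segment ℝ a b ∩ S := ⟨h, hx⟩
        rwa [hi] at this)
      have hxa : x ≠ a := by rintro rfl; exact haS hx
      filter_upwards [hK x (Or.inr hx) hxa hxc, hseg.isOpen_compl.mem_nhds hxseg] with x' h3 h4 h5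
      exact (h3 h5).resolve_left h4
    · filter_upwards [hseg.isOpen_compl.mem_nhds hcseg] with x hx
      exact ⟨fun h => h.resolve_left hx, Or.inr⟩

/-! ### The angle under which an arc is seen -/

/-- If the quotient were a nonpositive real, `x` would be a convex combination of `a` and `b`. Thus
`arg` of this quotient, the angle of the segment seen from `x`, is continuous off the segment. -/
theorem div_mem_slitPlane {a b x : ℂ} (hx : x ∉ segment ℝ a b) :
    (b - x) / (a - x) ∈ Complex.slitPlane := by
  have hxa : a - x ≠ 0 := sub_ne_zero.2 fun h => hx (h ▸ left_mem_segment ℝ a b)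
  by_contra hu
  rw [Complex.mem_slitPlane_iff] at hu
  push Not at hu
  obtain ⟨hre, him⟩ := hu
  set u := (b - x) / (a - x) with hudef
  have hu : u = (u.re : ℂ) := Complex.ext rfl (by simp [him])
  have h1 : b - x = u.re * (a - x) := by
    rw [← hu, hudef]; field_simp
  refine hx ?_
  rw [segment_eq_image']
  have h0 : 0 < 1 - u.re := by linarith
  have h0' : (1 - u.re : ℂ) ≠ 0 := by exact_mod_cast h0.ne'
  refine ⟨1 / (1 - u.re), ⟨by positivity, (div_le_one h0).2 (by linarith)⟩, ?_⟩
  simp only [Complex.real_smul]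
  push_cast
  field_simp
  linear_combination h1

/-- The two sides differ by a multiple of 2π that depends continuously on `x` near `x₀` and vanishes
at `x₀`. -/
theorem arg_div_locally {a b x₀ : ℂ} (hx : x₀ ∉ segment ℝ a b) :
    ∀ᶠ x in 𝓝 x₀, ((b - x) / (a - x)).arg - ((b - x₀) / (a - x₀)).arg =
      ((b - x) / (b - x₀)).arg - ((a - x) / (a - x₀)).arg := by
  have ha : a - x₀ ≠ 0 := sub_ne_zero.2 fun h => hx (h ▸ left_mem_segment ℝ a b)
  have hb : b - x₀ ≠ 0 := sub_ne_zero.2 fun h => hx (h ▸ right_mem_segment ℝ a b)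
  have h1 : ∀ w : ℂ, w - x₀ ≠ 0 → ContinuousAt (fun x => ((w - x) / (w - x₀)).arg) x₀ :=
    fun w hw => (Complex.continuousAt_arg (by simp [div_self hw])).comp
      (f := fun x => (w - x) / (w - x₀)) (by fun_prop)
  have h2 : ContinuousAt (fun x => ((b - x) / (a - x)).arg) x₀ :=
    (Complex.continuousAt_arg (div_mem_slitPlane hx)).comp
      (f := fun x => (b - x) / (a - x)) (by fun_prop (disch := assumption))
  have h3 : ContinuousAt (fun x => ((b - x) / (a - x)).arg - ((b - x₀) / (a - x₀)).arg -
      (((b - x) / (b - x₀)).arg - ((a - x) / (a - x₀)).arg)) x₀ :=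
    (h2.sub continuousAt_const).sub ((h1 b hb).sub (h1 a ha))
  have h4 : ∀ᶠ x in 𝓝 x₀, |((b - x) / (a - x)).arg - ((b - x₀) / (a - x₀)).arg -
      (((b - x) / (b - x₀)).arg - ((a - x) / (a - x₀)).arg)| < 2 * Real.pi := by
    refine h3.abs.eventually_lt continuousAt_const ?_
    simp [div_self ha, div_self hb, Real.pi_pos]
  have hc : Continuous fun x : ℂ => x := continuous_id
  have h5 : ∀ᶠ x in 𝓝 x₀, a - x ≠ 0 :=
    (continuousAt_const.sub hc.continuousAt).eventually_ne ha
  have h6 : ∀ᶠ x in 𝓝 x₀, b - x ≠ 0 :=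
    (continuousAt_const.sub hc.continuousAt).eventually_ne hb
  filter_upwards [h4, h5, h6] with x h7 hxa hxb
  have h8 : ((((b - x) / (a - x)).arg - ((b - x₀) / (a - x₀)).arg -
      (((b - x) / (b - x₀)).arg - ((a - x) / (a - x₀)).arg) : ℝ) : Real.Angle) = (0 : ℝ) := by
    simp only [Real.Angle.coe_sub, Real.Angle.coe_zero]
    rw [Complex.arg_div_coe_angle hxb hxa, Complex.arg_div_coe_angle hb ha,
      Complex.arg_div_coe_angle hxb hb, Complex.arg_div_coe_angle hxa ha]
    abel_nf
  set D := ((b - x) / (a - x)).arg - ((b - x₀) / (a - x₀)).arg -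
      (((b - x) / (b - x₀)).arg - ((a - x) / (a - x₀)).arg) with hD
  rw [abs_lt] at h7
  rcases lt_trichotomy D 0 with h | h | h
  · exact absurd h8.symm (angle_ne_of_lt h (by linarith))
  · linarith
  · exact absurd h8 (angle_ne_of_lt h (by linarith))

theorem tendsto_arg_div_circleMap {a : ℂ} {r R α : ℝ} (hr : 0 < r) (hrR : r < R) :
    Tendsto (fun t => ((circleMap a R α - circleMap a r t) / (a - circleMap a r t)).arg)
      (𝓝[>] α) (𝓝 Real.pi) ∧
    Tendsto (fun t => ((circleMap a R α - circleMap a r t) / (a - circleMap a r t)).arg)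
      (𝓝[<] α) (𝓝 (-Real.pi)) := by
  have h1 : ∀ t : ℝ, (circleMap a R α - circleMap a r t) / (a - circleMap a r t) =
      1 - (R / r : ℝ) * Complex.exp ((α - t : ℝ) * Complex.I) := fun t => by
    have h2 : Complex.exp ((α - t : ℝ) * Complex.I)
        = Complex.exp (α * Complex.I) / Complex.exp (t * Complex.I) := by
      rw [← Complex.exp_sub]; push_cast; ring_nf
    have h3 := Complex.exp_ne_zero (t * Complex.I)
    have h4 : (r : ℂ) ≠ 0 := by exact_mod_cast hr.ne'
    rw [h2]
    simp only [circleMap]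
    push_cast
    have h5 : a - (a + r * Complex.exp (t * Complex.I)) ≠ 0 := by
      simp [h4]
    field_simp
    ring
  simp only [h1]
  set u : ℝ → ℂ := fun t => 1 - (R / r : ℝ) * Complex.exp ((α - t : ℝ) * Complex.I) with hu
  have him : ∀ t, (u t).im = (R / r) * Real.sin (t - α) := fun t => by
    simp only [hu, Complex.sub_im, Complex.one_im]
    rw [Complex.im_ofReal_mul, Complex.exp_ofReal_mul_I_im, ← neg_sub t α, Real.sin_neg]
    ring
  have hRr : 1 < R / r := (one_lt_div hr).2 hrR
  have hua : u α = (1 - R / r : ℝ) := by simp [hu]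
  have hre0 : (u α).re < 0 := by rw [hua, Complex.ofReal_re]; linarith
  have him0 : (u α).im = 0 := by rw [hua, Complex.ofReal_im]
  have hcont : Continuous u := by fun_prop
  have hpi := Real.pi_pos
  constructor
  · refine (Complex.tendsto_arg_nhdsWithin_im_nonneg_of_re_neg_of_im_zero hre0 him0).comp
      (tendsto_nhdsWithin_iff.2 ⟨hcont.continuousAt.mono_left nhdsWithin_le_nhds, ?_⟩)
    filter_upwards [Ioo_mem_nhdsGT (show α < α + Real.pi by linarith)] with t ht
    change 0 ≤ (u t).im
    rw [him]
    exact (mul_pos (by linarith)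
      (Real.sin_pos_of_pos_of_lt_pi (by linarith [ht.1]) (by linarith [ht.2]))).le
  · refine (Complex.tendsto_arg_nhdsWithin_im_neg_of_re_neg_of_im_zero hre0 him0).comp
      (tendsto_nhdsWithin_iff.2 ⟨hcont.continuousAt.mono_left nhdsWithin_le_nhds, ?_⟩)
    filter_upwards [Ioo_mem_nhdsLT (show α - Real.pi < α by linarith)] with t ht
    change (u t).im < 0
    rw [him]
    exact mul_neg_of_pos_of_neg (by linarith)
      (Real.sin_neg_of_neg_of_neg_pi_lt (by linarith [ht.2]) (by linarith [ht.1]))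

/-- `θ` behaves off the arc `S` like the angle under which the arc is seen. -/
def IsAngleFunction (θ : ℂ → ℝ) (a c : ℂ) (S : Set ℂ) : Prop :=
  ∀ x₀ ∉ S, ∀ᶠ x in 𝓝 x₀,
    θ x - θ x₀ = ((c - x) / (c - x₀)).arg - ((a - x) / (a - x₀)).arg

theorem IsAngleFunction.continuousAt {θ : ℂ → ℝ} {a c x₀ : ℂ} {S : Set ℂ}
    (h : IsAngleFunction θ a c S) (ha : a ∈ S) (hc : c ∈ S) (hx : x₀ ∉ S) :
    ContinuousAt θ x₀ := by
  have h1 : ∀ w ∈ S, ContinuousAt (fun x => ((w - x) / (w - x₀)).arg) x₀ := fun w hw => by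
    have hw : w - x₀ ≠ 0 := sub_ne_zero.2 (by rintro rfl; exact hx hw)
    exact (Complex.continuousAt_arg (by simp [div_self hw])).comp
      (f := fun x => (w - x) / (w - x₀)) (by fun_prop)
  have h2 : ContinuousAt (fun x => θ x₀ +
      (((c - x) / (c - x₀)).arg - ((a - x) / (a - x₀)).arg)) x₀ :=
    continuousAt_const.add ((h1 c hc).sub (h1 a ha))
  refine h2.congr ?_
  filter_upwards [h x₀ hx] with x hx
  linarith

/-- Add the angles of the segments: the contributions of the intermediate corners telescope. Near
`a` only the first segment jumps, from `-π` to `π`, because the rest of the arc stays away from `a`.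
-/
theorem IsPolyArc.exists_angleFunction {a c : ℂ} {S : Set ℂ} (h : IsPolyArc a c S) :
    ∃ θ : ℂ → ℝ, IsAngleFunction θ a c S ∧ ∀ α, RadialAt S a α →
      ∀ᶠ r in 𝓝[>] (0 : ℝ), ∃ l,
        Tendsto (fun t => θ (circleMap a r t)) (𝓝[>] α) (𝓝 (l + Real.pi)) ∧
        Tendsto (fun t => θ (circleMap a r t)) (𝓝[<] α) (𝓝 (l - Real.pi)) := by
  have key : ∀ (a : ℂ) (R γ α : ℝ), 0 < R → (α : Real.Angle) = γ → ∀ r ∈ Ioo 0 R,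
      Tendsto (fun t => ((circleMap a R γ - circleMap a r t) / (a - circleMap a r t)).arg)
        (𝓝[>] α) (𝓝 Real.pi) ∧
      Tendsto (fun t => ((circleMap a R γ - circleMap a r t) / (a - circleMap a r t)).arg)
        (𝓝[<] α) (𝓝 (-Real.pi)) := fun a R γ α hR hα r hr => by
    rw [circleMap_congr_angle hα.symm]
    exact tendsto_arg_div_circleMap hr.1 hr.2
  induction h with
  | single a b hab =>
    refine ⟨fun x => ((b - x) / (a - x)).arg, fun x₀ hx => arg_div_locally hx, fun α hα => ?_⟩
    obtain ⟨R, hR, γ, rfl⟩ := exists_eq_circleMap hab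
    filter_upwards [Ioo_mem_nhdsGT hR] with r hr
    have := key a R γ α hR (hα.unique (radialAt_segment hR)) r hr
    exact ⟨0, by simpa using this⟩
  | cons a b c S hab hS hi ih =>
    obtain ⟨θ, hθ, -⟩ := ih
    refine ⟨fun x => ((b - x) / (a - x)).arg + θ x, fun x₀ hx => ?_, fun α hα => ?_⟩
    · filter_upwards [arg_div_locally (fun h => hx (Or.inl h)),
        hθ x₀ (fun h => hx (Or.inr h))] with x h1 h2
      linarith
    · obtain ⟨R, hR, γ, rfl⟩ := exists_eq_circleMap hab
      set b := circleMap a R γ with hb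
      have haS : a ∉ S := fun ha => hab (by
        have : a ∈ segment ℝ a b ∩ S := ⟨left_mem_segment ℝ _ _, ha⟩
        rwa [hi] at this)
      have h1 : (α : Real.Angle) = γ := by
        refine (hα.congr ?_).unique (radialAt_segment hR)
        filter_upwards [hS.isClosed.isOpen_compl.mem_nhds haS] with x hx
        exact ⟨fun h => h.resolve_right hx, Or.inl⟩
      filter_upwards [Ioo_mem_nhdsGT hR,
        eventually_forall_circleMap (hS.isClosed.isOpen_compl.mem_nhds haS)] with r hr h2
      obtain ⟨h3, h4⟩ := key a R γ α hR h1 r hr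
      have h5 : Tendsto (fun t => θ (circleMap a r t)) (𝓝 α) (𝓝 (θ (circleMap a r α))) :=
        (hθ.continuousAt hS.left_mem hS.right_mem (h2 α)).tendsto.comp
          ((continuous_circleMap a r).tendsto α)
      refine ⟨θ (circleMap a r α), ?_, ?_⟩
      · rw [add_comm]; exact h3.add (h5.mono_left nhdsWithin_le_nhds)
      · rw [sub_eq_neg_add]; exact h4.add (h5.mono_left nhdsWithin_le_nhds)

/-! ### The rotation of a plane drawing -/

theorem eq_of_angle_eq_of_mem_Ioc {s t : ℝ} (hs : s ∈ Ioc (-Real.pi) Real.pi)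
    (ht : t ∈ Ioc (-Real.pi) Real.pi) (h : (s : Real.Angle) = t) : s = t := by
  rcases lt_trichotomy s t with h' | h' | h'
  · exact absurd h.symm (angle_ne_of_lt h' (by linarith [hs.1, ht.2]))
  · exact h'
  · exact absurd h (angle_ne_of_lt h' (by linarith [hs.2, ht.1]))

open scoped Fin.NatCast Fin.CommRing in
/-- The cyclic order of finitely many directions. -/
theorem exists_cyclic_perm {N : Type*} [Fintype N] (f : N → ℝ) (hf : Function.Injective f)
    (hI : ∀ x, f x ∈ Ioc (-Real.pi) Real.pi) :
    ∃ σ : Equiv.Perm N, (∀ x (k : ℕ), (σ ^ k) x = x ↔ Fintype.card N ∣ k) ∧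
      ∀ x, ∃ β : ℝ, (β : Real.Angle) = f (σ x) ∧ f x < β ∧
        ∀ t ∈ Ioo (f x) β, ∀ y, (t : Real.Angle) ≠ f y := by
  rcases isEmpty_or_nonempty N with hN | hN
  · exact ⟨1, fun x => isEmptyElim x, fun x => isEmptyElim x⟩
  obtain ⟨m, hm⟩ : ∃ m, Fintype.card N = m + 1 :=
    ⟨Fintype.card N - 1, (Nat.succ_pred_eq_of_pos Fintype.card_pos).symm⟩
  let _ : LinearOrder N := LinearOrder.lift' f hf
  have hmono : StrictMono f := fun _ _ h => h
  let e : Fin (m + 1) ≃o N := Fintype.orderIsoFinOfCardEq N hm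
  let σ : Equiv.Perm N := e.symm.toEquiv.trans ((finRotate (m + 1)).trans e.toEquiv)
  have hσ : ∀ i, σ (e i) = e (i + 1) := fun i => by simp [σ]
  have hpow : ∀ (k : ℕ) (i : Fin (m + 1)), (σ ^ k) (e i) = e (i + (k : Fin (m + 1))) := fun k => by
    induction k with
    | zero => simp
    | succ k ih => intro i; rw [pow_succ', Equiv.Perm.mul_apply, ih, hσ]; push_cast; rw [add_assoc]
  refine ⟨σ, fun x k => ?_, fun x => ?_⟩
  · obtain ⟨i, rfl⟩ := e.surjective x
    rw [hpow, e.injective.eq_iff, add_eq_left, Fin.natCast_eq_zero, hm]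
  · obtain ⟨i, rfl⟩ := e.surjective x
    rw [hσ]
    have hpi := Real.pi_pos
    by_cases hi : i = Fin.last m
    · subst hi
      rw [Fin.last_add_one]
      have h0 := hI (e 0)
      have h1 := hI (e (Fin.last m))
      -- After the largest angle the order wraps around, so the next direction is the smallest one
      -- shifted by a full turn.
      refine ⟨f (e 0) + 2 * Real.pi, by simp, by linarith [h0.1, h1.2], fun t ht y hy => ?_⟩
      have hyI := hI y
      obtain ⟨j, rfl⟩ := e.surjective y
      rcases le_or_gt t Real.pi with htp | htp
      · have h2 := eq_of_angle_eq_of_mem_Ioc ⟨by linarith [ht.1, h1.1], htp⟩ hyI hy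
        have h3 : f (e j) ≤ f (e (Fin.last m)) := hmono.monotone (e.monotone (Fin.le_last j))
        linarith [ht.1]
      · have h2 := eq_of_angle_eq_of_mem_Ioc (s := t - 2 * Real.pi)
          ⟨by linarith, by linarith [ht.2, h0.2]⟩ hyI (by simpa using hy)
        have h3 : f (e 0) ≤ f (e j) := hmono.monotone (e.monotone (Fin.zero_le j))
        linarith [ht.2]
    · have hlt : i < i + 1 := Fin.lt_add_one_iff.2 (lt_of_le_of_ne (Fin.le_last i) hi)
      refine ⟨f (e (i + 1)), rfl, hmono (e.strictMono hlt), fun t ht y hy => ?_⟩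
      have h2 := eq_of_angle_eq_of_mem_Ioc
        ⟨by linarith [ht.1, (hI (e i)).1], by linarith [ht.2, (hI (e (i + 1))).2]⟩ (hI y) hy
      obtain ⟨j, rfl⟩ := e.surjective y
      rw [h2] at ht
      have h3 : i < j := by
        rw [← e.lt_iff_lt, ← hmono.lt_iff_lt]; exact ht.1
      have h4 : j < i + 1 := by
        rw [← e.lt_iff_lt, ← hmono.lt_iff_lt]; exact ht.2
      have h5 : (i : ℕ) < j := h3
      have h6 : (j : ℕ) < (i + 1 : Fin (m + 1)) := h4
      rw [Fin.val_add_one, if_neg hi] at h6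
      omega

/-- A rotation at every vertex of `G`, for which every flow on the edges (oriented by `o`) is the
difference of a potential that is constant on the faces. -/
def IsPlanarRotation {V : Type*} {G : SimpleGraph V} [Fintype V] [DecidableEq V]
    [DecidableRel G.Adj] (o : G.edgeSet → G.Dart) (σ : Equiv.Perm G.Dart) : Prop :=
  (∀ d, (σ d).fst = d.fst) ∧ (∀ d (k : ℕ), (σ ^ k) d = d ↔ G.degree d.fst ∣ k) ∧
    ∀ y : G.edgeSet → ℝ, (∀ v, ∑ e, y e * ((if (o e).snd = v then 1 else 0) -
        (if (o e).fst = v then 1 else 0)) = 0) →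
      ∃ l : G.Dart → ℝ, (∀ d, l (σ d).symm = l d) ∧ ∀ e, l (o e) - l (o e).symm = y e

/-- The rotation orders the darts at a vertex counterclockwise. The potential of a dart is the
value, just to its left, of the weighted sum of angle functions. That value is also the one to the
right of the next dart, hence to the left of the reversal of that dart. -/
theorem PlaneDrawing.exists_isPlanarRotation {V : Type*} {G : SimpleGraph V} [Fintype V]
    [DecidableEq V] [DecidableRel G.Adj] (D : PlaneDrawing G) (o : G.edgeSet → G.Dart)
    (ho : ∀ e, (o e).edge = e) : ∃ σ, IsPlanarRotation o σ := by
  have hpi := Real.pi_pos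
  set f := Complex.equivRealProdCLM.symm with hf
  let P : V → ℂ := fun v => f (D.pt v)
  let A : G.Dart → Set ℂ := fun d => f '' D.arc d.edge
  have hP : Function.Injective P := f.injective.comp D.pt_injective
  have hA : ∀ d, IsPolyArc (P d.fst) (P d.snd) (A d) := fun d =>
    (D.isPolygonalArc d.fst d.snd d.adj).image
  have hAsymm : ∀ d, A d.symm = A d := fun d => by simp only [A, SimpleGraph.Dart.edge_symm]
  have hmem : ∀ d w, P w ∈ A d → w = d.fst ∨ w = d.snd := fun d w hw => by
    obtain ⟨x, hx, hxw⟩ := hw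
    rw [f.injective hxw] at hx
    exact Sym2.mem_iff.1 (D.mem_of_pt_mem_arc d.edge d.edge_mem w hx)
  have hcross : ∀ d d' x, d.edge ≠ d'.edge → x ∈ A d → x ∈ A d' →
      ∃ w, w ∈ d.edge ∧ w ∈ d'.edge ∧ P w = x := fun d d' x hne hx hx' => by
    obtain ⟨z, hz, rfl⟩ := hx
    obtain ⟨z', hz', hzz⟩ := hx'
    rw [f.injective hzz] at hz'
    obtain ⟨w, h1, h2, h3⟩ := D.eq_pt_of_mem_arc _ d.edge_mem _ d'.edge_mem hne z ⟨hz, hz'⟩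
    exact ⟨w, h1, h2, congrArg f h3⟩
  have hang : ∀ d, ∃ α : ℝ, RadialAt (A d) (P d.fst) α ∧ α ∈ Ioc (-Real.pi) Real.pi := fun d => by
    obtain ⟨α, hα⟩ := (hA d).exists_radialAt_left
    exact ⟨(α : Real.Angle).toReal, hα.congr_angle (by simp),
      Real.Angle.neg_pi_lt_toReal _, Real.Angle.toReal_le_pi _⟩
  choose ang hrad hangI using hang
  let K : Set ℂ := ⋃ d, A d
  have hnear : ∀ v, ∀ᶠ r in 𝓝[>] (0 : ℝ), ∀ t, circleMap (P v) r t ∈ K →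
      ∃ d : G.Dart, d.fst = v ∧ (t : Real.Angle) = ang d := fun v => by
    have h1 : ∀ d : G.Dart, ∀ᶠ r in 𝓝[>] (0 : ℝ), ∀ t, circleMap (P v) r t ∈ A d →
        ∃ d : G.Dart, d.fst = v ∧ (t : Real.Angle) = ang d := fun d => by
      by_cases h1 : v = d.fst
      · subst h1
        filter_upwards [hrad d] with r hr t ht
        exact ⟨d, rfl, (hr t).1 ht⟩
      by_cases h2 : v = d.snd
      · subst h2
        filter_upwards [hrad d.symm] with r hr t ht
        exact ⟨d.symm, rfl, (hr t).1 (by rwa [hAsymm])⟩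
      · have h3 : P v ∉ A d := fun h => (hmem d v h).elim h1 h2
        filter_upwards [eventually_forall_circleMap
          ((hA d).isClosed.isOpen_compl.mem_nhds h3)] with r hr t ht
        exact absurd ht (hr t)
    filter_upwards [eventually_all.2 h1] with r hr t ht
    obtain ⟨d, hd⟩ := mem_iUnion.1 ht
    exact hr d t hd
  have hdisj : ∀ d, ∀ x ∈ A d, x ≠ P d.fst → x ≠ P d.snd → ∀ d' : G.Dart, d'.edge ≠ d.edge →
      x ∉ A d' := fun d x hx h1 h2 d' hne hx' => by
    obtain ⟨w, h3, h4, rfl⟩ := hcross d' d x hne hx' hx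
    rcases Sym2.mem_iff.1 h4 with rfl | rfl
    · exact h1 rfl
    · exact h2 rfl
  have hfollow : ∀ d, ∀ x ∈ A d, x ≠ P d.fst → x ≠ P d.snd →
      ∀ᶠ x' in 𝓝 x, x' ∈ K → x' ∈ A d := fun d x hx h1 h2 => by
    have h3 : ∀ d' : G.Dart, ∀ᶠ x' in 𝓝 x, x' ∈ A d' → x' ∈ A d := fun d' => by
      by_cases he : d'.edge = d.edge
      · refine Eventually.of_forall fun x' hx' => ?_
        simpa only [A, he] using hx'
      · filter_upwards [(hA d').isClosed.isOpen_compl.mem_nhds (hdisj d x hx h1 h2 d' he)]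
          with x' h3 h4
        exact absurd h4 h3
    filter_upwards [eventually_all.2 h3] with x' h4 h5
    obtain ⟨d', hd'⟩ := mem_iUnion.1 h5
    exact h4 d' hd'
  -- Arcs of distinct edges leaving a vertex in the same direction share a point near it. This point
  -- must be a common vertex other than the start, so both darts have the same head.
  have hinj : ∀ d d' : G.Dart, d.fst = d'.fst → ang d = ang d' → d = d' := fun d d' hfst h => by
    by_contra hne
    have hedge : d.edge ≠ d'.edge := fun he => by
      rcases SimpleGraph.dart_edge_eq_iff d d' |>.1 he with h1 | h1
      · exact hne h1
      · rw [h1] at hfst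
        exact d'.adj.ne hfst.symm
    obtain ⟨r, ⟨hr1, hr2⟩, hr3⟩ := (((hrad d).and (hrad d')).and
      (self_mem_nhdsWithin : Ioi (0 : ℝ) ∈ _)).exists
    have h1 := (hr1 (ang d)).2 rfl
    have h2 := (hr2 (ang d)).2 (by rw [h])
    rw [← hfst] at h2
    obtain ⟨w, h3, h4, h5⟩ := hcross d d' _ hedge h1 h2
    have hw : w ≠ d.fst := by
      rintro rfl
      rw [eq_comm, circleMap_eq_center_iff] at h5
      exact ne_of_gt hr3 h5
    have e1 : w = d.snd := (Sym2.mem_iff.1 h3).resolve_left hw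
    have e2 : w = d'.snd := (Sym2.mem_iff.1 h4).resolve_left (by rwa [← hfst])
    exact hne (SimpleGraph.Dart.ext _ _ (Prod.ext hfst (e1.symm.trans e2)))
  have hcyc := fun v => exists_cyclic_perm (N := {d : G.Dart // d.fst = v}) (fun d => ang d)
    (fun d d' h => Subtype.ext (hinj _ _ (d.2.trans d'.2.symm) h)) (fun d => hangI d)
  choose s hs1 hs2 using hcyc
  let σ : Equiv.Perm G.Dart := (Equiv.sigmaFiberEquiv fun d : G.Dart => d.fst).permCongr
    (Equiv.Perm.sigmaCongrRight s)
  have hσ : ∀ d, σ d = (s d.fst ⟨d, rfl⟩).1 := fun d => rfl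
  have hσ' : ∀ v (d : {d : G.Dart // d.fst = v}), σ d = (s v d).1 := by
    rintro v ⟨d, rfl⟩; rfl
  have hσpow : ∀ (k : ℕ) v (d : {d : G.Dart // d.fst = v}), (σ ^ k) d = ((s v ^ k) d).1 := by
    intro k v d
    induction k with
    | zero => rfl
    | succ k ih => rw [pow_succ', pow_succ', Equiv.Perm.mul_apply, Equiv.Perm.mul_apply, ih, hσ']
  have hσfst : ∀ d, (σ d).fst = d.fst := fun d => (s d.fst ⟨d, rfl⟩).2
  refine ⟨σ, hσfst, fun d k => ?_, fun y hy => ?_⟩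
  · have h1 := hs1 d.fst ⟨d, rfl⟩ k
    have h2 : Fintype.card {d' : G.Dart // d'.fst = d.fst} = G.degree d.fst := by
      rw [Fintype.card_subtype]; exact G.dart_fst_fiber_card_eq_degree d.fst
    rw [h2] at h1
    rw [← h1, Subtype.ext_iff, ← hσpow]
  choose θ hθ1 hθ2 using fun d => (hA d).exists_angleFunction
  let g : ℂ → ℝ := fun x => ∑ e, y e * θ (o e) x
  have hg : LocConstOff g K := fun x₀ hx₀ => by
    have h1 : ∀ᶠ x in 𝓝 x₀, ∀ e, θ (o e) x - θ (o e) x₀ =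
        ((P (o e).snd - x) / (P (o e).snd - x₀)).arg -
          ((P (o e).fst - x) / (P (o e).fst - x₀)).arg :=
      eventually_all.2 fun e => hθ1 (o e) x₀ fun h => hx₀ (mem_iUnion.2 ⟨_, h⟩)
    filter_upwards [h1] with x hx
    rw [← sub_eq_zero]
    set B : V → ℝ := fun v => ((P v - x) / (P v - x₀)).arg with hB
    calc g x - g x₀ = ∑ e, y e * (B (o e).snd - B (o e).fst) := by
          simp only [g, ← Finset.sum_sub_distrib, ← mul_sub, hx]; rfl
      -- Regroup by vertices: the change of direction towards `v` is multiplied by the net flow at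
      -- `v`, which is zero.
      _ = ∑ e, ∑ v, B v * (y e * ((if (o e).snd = v then 1 else 0) -
            (if (o e).fst = v then 1 else 0))) := by
          refine Finset.sum_congr rfl fun e _ => ?_
          simp only [mul_sub, mul_ite, mul_one, mul_zero, Finset.sum_sub_distrib,
            Finset.sum_ite_eq, Finset.mem_univ, if_true]
          ring
      _ = 0 := by
          rw [Finset.sum_comm]
          simp only [← Finset.mul_sum, hy, mul_zero, Finset.sum_const_zero]
  have hsector : ∀ d, ∃ z, LeftGerm g (P d.fst) (ang d) z ∧
      RightGerm g (P d.fst) (ang (σ d)) z := fun d => by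
    obtain ⟨β, hβ1, hβ2, hβ3⟩ := hs2 d.fst ⟨d, rfl⟩
    obtain ⟨z, hz1, hz2⟩ := hg.exists_germ (p := P d.fst) hβ2 (by
      filter_upwards [hnear d.fst] with r hr t ht htK
      obtain ⟨d', hd', htd⟩ := hr t htK
      exact hβ3 t ht ⟨d', hd'⟩ htd)
    exact ⟨z, hz1, hz2.congr_angle hβ1⟩
  choose l hl1 hl2 using hsector
  have hl3 : ∀ d : G.Dart, RightGerm g (P d.fst) (ang d) (l d.symm) := fun d =>
    (hA d.symm).rightGerm_of_leftGerm hg (hfollow d.symm) (hrad d.symm)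
      (by rw [hAsymm]; exact hrad d) (hl1 d.symm)
  -- Across the arc of `e` the sum jumps by `2π * y e`; the division normalises this to `y e`.
  refine ⟨fun d => l d / (2 * Real.pi), fun d => ?_, fun e => ?_⟩
  · have h1 := hl3 (σ d)
    rw [hσfst] at h1
    simp only [h1.unique (hl2 d)]
  · set d := o e with hd
    have hfs : ∀ᶠ r in 𝓝[>] (0 : ℝ), ∀ t, circleMap (P d.fst) r t ≠ P d.snd :=
      eventually_forall_circleMap (isOpen_ne.mem_nhds (hA d).ne)
    obtain ⟨r, h1, h2, h3, h4, ⟨c, hc1, hc2⟩, hr⟩ := ((hl1 d).and ((hl3 d).and ((hrad d).and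
      (hfs.and ((hθ2 d (ang d) (hrad d)).and
        (self_mem_nhdsWithin : Ioi (0 : ℝ) ∈ _)))))).exists
    -- At an interior point of the arc of `e` all other angle functions are continuous, so they
    -- cancel when the two sides are compared.
    have hq : ∀ e' ∈ Finset.univ.erase e,
        ContinuousAt (θ (o e')) (circleMap (P d.fst) r (ang d)) := fun e' he' => by
      refine (hθ1 (o e')).continuousAt (hA _).left_mem (hA _).right_mem
        (hdisj d _ ((h3 _).2 rfl) ?_ (h4 _) _ ?_)
      · rw [Ne, circleMap_eq_center_iff]
        exact ne_of_gt hr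
      · rw [hd, ho, ho]
        exact fun h => Finset.ne_of_mem_erase he' (Subtype.ext h)
    have hrest : Tendsto (fun t => ∑ e' ∈ Finset.univ.erase e,
        y e' * θ (o e') (circleMap (P d.fst) r t)) (𝓝 (ang d))
        (𝓝 (∑ e' ∈ Finset.univ.erase e, y e' * θ (o e') (circleMap (P d.fst) r (ang d)))) :=
      tendsto_finsetSum _ fun e' he' => ((hq e' he').tendsto.comp
        ((continuous_circleMap _ r).tendsto _)).const_mul _
    have hsplit : ∀ x, g x = y e * θ d x + ∑ e' ∈ Finset.univ.erase e, y e' * θ (o e') x :=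
      fun x => (Finset.add_sum_erase _ _ (Finset.mem_univ e)).symm
    have hL := (hc1.const_mul (y e)).add (hrest.mono_left nhdsWithin_le_nhds)
    have hR := (hc2.const_mul (y e)).add (hrest.mono_left nhdsWithin_le_nhds)
    simp only [← hsplit] at hL hR
    have eL := tendsto_nhds_unique (tendsto_const_nhds.congr'
      (EventuallyEq.symm (f := fun t => g (circleMap (P d.fst) r t)) h1)) hL
    have eR := tendsto_nhds_unique (tendsto_const_nhds.congr'
      (EventuallyEq.symm (f := fun t => g (circleMap (P d.fst) r t)) h2)) hR
    rw [← sub_div, eL, eR]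
    field_simp
    ring

end Germs

/-! ### Euler's inequality and the edge bound for minimum degree two -/

section Euler
variable {V : Type*} {G : SimpleGraph V}

/-- The permutation of the darts that runs around the faces of the rotation `σ`. -/
def facePerm (σ : Equiv.Perm G.Dart) : Equiv.Perm G.Dart :=
  σ.trans (SimpleGraph.Dart.symm_involutive (G := G)).toPerm

theorem facePerm_apply (σ : Equiv.Perm G.Dart) (d : G.Dart) : facePerm σ d = (σ d).symm := rfl

/-- The faces of a rotation. -/
def RotationFace (σ : Equiv.Perm G.Dart) : Type _ :=
  Quotient (Equiv.Perm.SameCycle.setoid (facePerm σ))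

/-- The face that a dart runs along. -/
def faceOf (σ : Equiv.Perm G.Dart) (d : G.Dart) : RotationFace σ := Quotient.mk _ d

variable [Fintype V] [DecidableEq V] [DecidableRel G.Adj]

noncomputable instance (σ : Equiv.Perm G.Dart) : Fintype (RotationFace σ) :=
  @Quotient.fintype _ _ _ (Classical.decRel _)

variable {o : G.edgeSet → G.Dart} {σ : Equiv.Perm G.Dart}

/-- Flows form a space of dimension at least E - (V - 1), as the entries of a boundary sum to zero.
All of them are coboundaries of face functions, a space of dimension at most F - 1, as constants
have coboundary zero. Connectedness plays no role. -/
theorem IsPlanarRotation.card_edgeSet_add_two_le (h : IsPlanarRotation o σ) [Nonempty G.Dart] :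
    Fintype.card G.edgeSet + 2 ≤ Fintype.card (RotationFace σ) + Fintype.card V := by
  let dv : (G.edgeSet → ℝ) →ₗ[ℝ] (V → ℝ) :=
    { toFun := fun y v => ∑ e, y e * ((if (o e).snd = v then 1 else 0) -
        (if (o e).fst = v then 1 else 0))
      map_add' := fun y z => by
        ext v; simp only [Pi.add_apply, add_mul, Finset.sum_add_distrib]
      map_smul' := fun c y => by
        ext v; simp only [Pi.smul_apply, smul_eq_mul, mul_assoc, Finset.mul_sum, RingHom.id_apply] }
  let T : (RotationFace σ → ℝ) →ₗ[ℝ] (G.edgeSet → ℝ) :=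
    { toFun := fun f e => f (faceOf σ (o e)) - f (faceOf σ (o e).symm)
      map_add' := fun y z => by
        ext v; simp only [Pi.add_apply]; ring
      map_smul' := fun c y => by
        ext v; simp only [Pi.smul_apply, smul_eq_mul, RingHom.id_apply]; ring }
  have hker : LinearMap.ker dv ≤ LinearMap.range T := fun y hy => by
    obtain ⟨l, hl1, hl2⟩ := h.2.2 y fun v => congrFun hy v
    have hl3 : ∀ d d', (facePerm σ).SameCycle d d' → l d = l d' := fun d d' hd => by
      obtain ⟨i, -, rfl⟩ := hd.exists_pow_eq'
      clear hd
      induction i with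
      | zero => rfl
      | succ i ih => rw [pow_succ', Equiv.Perm.mul_apply, facePerm_apply, hl1]; exact ih
    exact ⟨Quotient.lift l hl3, funext hl2⟩
  have h1 := Submodule.finrank_mono hker
  have h2 := dv.finrank_range_add_finrank_ker
  have h3 := T.finrank_range_add_finrank_ker
  have h4 : 0 < Module.finrank ℝ (LinearMap.ker T) := by
    rw [Module.finrank_pos_iff_exists_ne_zero]
    refine ⟨⟨fun _ => 1, ?_⟩, fun h0 => ?_⟩
    · ext e; simp [T]
    · have := congrFun (congrArg Subtype.val h0) (faceOf σ (Classical.arbitrary _))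
      exact one_ne_zero this
  have h5 : Module.finrank ℝ (LinearMap.range dv) < Module.finrank ℝ (V → ℝ) := by
    refine Submodule.finrank_lt (fun htop => ?_)
    have hsum : ∀ y, ∑ v, dv y v = 0 := fun y => by
      simp only [dv, LinearMap.coe_mk, AddHom.coe_mk]
      rw [Finset.sum_comm]
      simp [← Finset.mul_sum, Finset.sum_sub_distrib]
    obtain ⟨v⟩ : Nonempty V := ⟨(Classical.arbitrary G.Dart).fst⟩
    obtain ⟨y, hy⟩ := LinearMap.range_eq_top.1 htop (Pi.single v 1)
    have := hsum y
    rw [hy] at this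
    simp at this
  simp only [Module.finrank_fintype_fun_eq_card] at h2 h3 h5
  omega

theorem IsPlanarRotation.facePerm_ne (h : IsPlanarRotation o σ) (d : G.Dart) :
    facePerm σ d ≠ d := fun he => by
  have h1 : (facePerm σ d).snd = d.fst := h.1 d
  rw [he] at h1
  exact d.adj.ne h1.symm

/-- A face orbit of length two forces `σ d = d`, so the degree at `d.fst` would divide 1. -/
theorem IsPlanarRotation.facePerm_facePerm_ne (h : IsPlanarRotation o σ)
    (hdeg : ∀ v, 2 ≤ G.degree v) (d : G.Dart) : facePerm σ (facePerm σ d) ≠ d := fun he => by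
  have h1 : (facePerm σ (facePerm σ d)).snd = (facePerm σ d).fst := h.1 _
  rw [he] at h1
  have h2 : σ d = d := SimpleGraph.Dart.ext _ _ (Prod.ext (h.1 d) h1.symm)
  have h3 := (h.2.1 d 1).1 (by simpa using h2)
  have := hdeg d.fst
  have := Nat.le_of_dvd one_pos h3
  omega

theorem IsPlanarRotation.three_le_card_fiber (h : IsPlanarRotation o σ)
    (hdeg : ∀ v, 2 ≤ G.degree v) [DecidableEq (RotationFace σ)] (q : RotationFace σ) :
    3 ≤ (Finset.univ.filter fun d : G.Dart => faceOf σ d = q).card ∧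
    ((Finset.univ.filter fun d : G.Dart => faceOf σ d = q).card = 3 →
      ∀ d, faceOf σ d = q →
        facePerm σ (facePerm σ (facePerm σ d)) = d) := by
  set S := Finset.univ.filter fun d : G.Dart => faceOf σ d = q with hS
  have hstep : ∀ d ∈ S, facePerm σ d ∈ S := fun d hd => by
    simp only [hS, Finset.mem_filter, Finset.mem_univ, true_and] at hd ⊢
    rw [← hd]
    exact Quotient.sound (Equiv.Perm.SameCycle.symm ⟨1, by simp⟩)
  have hsub : ∀ d ∈ S, {d, facePerm σ d, facePerm σ (facePerm σ d)} ⊆ S := fun d hd => by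
    simp only [Finset.insert_subset_iff, Finset.singleton_subset_iff]
    exact ⟨hd, hstep _ hd, hstep _ (hstep _ hd)⟩
  have hcard : ∀ d, ({d, facePerm σ d, facePerm σ (facePerm σ d)} : Finset G.Dart).card = 3 :=
    fun d => Finset.card_eq_three.2 ⟨_, _, _, (h.facePerm_ne d).symm,
      (h.facePerm_facePerm_ne hdeg d).symm, (h.facePerm_ne _).symm, rfl⟩
  constructor
  · obtain ⟨d, hd : faceOf σ d = q⟩ := Quotient.exists_rep q
    have hdS : d ∈ S := by simpa [hS] using hd
    exact (hcard d).symm.trans_le (Finset.card_le_card (hsub d hdS))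
  · intro h3 d hd
    have hdS : d ∈ S := by simpa [hS] using hd
    have heq := Finset.eq_of_subset_of_card_le (hsub d hdS) (by rw [h3, hcard])
    have hm := hstep _ (hstep _ (hstep _ hdS))
    rw [← heq] at hm
    simp only [Finset.mem_insert, Finset.mem_singleton] at hm
    rcases hm with hm | hm | hm
    · exact hm
    · exact absurd ((facePerm σ).injective hm) (h.facePerm_facePerm_ne hdeg d)
    · exact absurd hm (h.facePerm_ne _)

/-- Each face has at least three darts, so 3F ≤ 2E; combine with Euler's inequality. Equality forces
exactly three darts in every face. -/
theorem IsPlanarRotation.card_edgeFinset_add_six_le (h : IsPlanarRotation o σ)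
    (hdeg : ∀ v, 2 ≤ G.degree v) [Nonempty G.Dart] :
    G.edgeFinset.card + 6 ≤ 3 * Fintype.card V ∧
    (G.edgeFinset.card + 6 = 3 * Fintype.card V →
      ∀ d, facePerm σ (facePerm σ (facePerm σ d)) = d) := by
  classical
  have h1 := h.card_edgeSet_add_two_le
  rw [← SimpleGraph.edgeFinset_card] at h1
  have h2 := G.dart_card_eq_twice_card_edges
  have h3 : Fintype.card G.Dart = ∑ q : RotationFace σ,
      (Finset.univ.filter fun d : G.Dart => faceOf σ d = q).card :=
    Finset.card_eq_sum_card_fiberwise (fun _ _ => Finset.mem_coe.2 (Finset.mem_univ _))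
  have h4 : 3 * Fintype.card (RotationFace σ) = ∑ _q : RotationFace σ, 3 := by
    simp [mul_comm]
  have h5 : 3 * Fintype.card (RotationFace σ) ≤ Fintype.card G.Dart := by
    rw [h4, h3]
    exact Finset.sum_le_sum fun q _ => (h.three_le_card_fiber hdeg q).1
  refine ⟨by omega, fun heq d => ?_⟩
  have h6 : Fintype.card G.Dart = 3 * Fintype.card (RotationFace σ) := by omega
  rw [h4, h3, eq_comm] at h6
  have h7 := (Finset.sum_eq_sum_iff_of_le
    fun q _ => (h.three_le_card_fiber hdeg q).1).1 h6 (faceOf σ d) (Finset.mem_univ _)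
  exact (h.three_le_card_fiber hdeg _).2 h7.symm d rfl

end Euler

/-! ### Planar graphs with the maximum number of edges -/

theorem IsPlanar.induce {V : Type*} {G : SimpleGraph V} (h : IsPlanar G) (s : Set V) :
    IsPlanar (G.induce s) := by
  obtain ⟨D⟩ := h
  have hmap : ∀ e : Sym2 s, e ∈ (G.induce s).edgeSet → e.map Subtype.val ∈ G.edgeSet :=
    Sym2.ind fun u v h => h
  exact ⟨{
    pt := fun v => D.pt v
    arc := fun e => D.arc (e.map Subtype.val)
    pt_injective := D.pt_injective.comp Subtype.val_injective
    isPolygonalArc := fun u v h => D.isPolygonalArc u v h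
    mem_of_pt_mem_arc := fun e he w hw => by
      obtain ⟨w', h1, h2⟩ := Sym2.mem_map.1 (D.mem_of_pt_mem_arc _ (hmap e he) w hw)
      rwa [← Subtype.ext h2]
    eq_pt_of_mem_arc := fun e he f hf hne x hx => by
      obtain ⟨w, h1, h2, h3⟩ := D.eq_pt_of_mem_arc _ (hmap e he) _ (hmap f hf)
        (fun h => hne (Sym2.map.injective Subtype.val_injective h)) x hx
      obtain ⟨w', h4, h5⟩ := Sym2.mem_map.1 h1
      obtain ⟨w'', h6, h7⟩ := Sym2.mem_map.1 h2
      obtain rfl : w' = w'' := Subtype.ext (h5.trans h7.symm)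
      exact ⟨w', h4, h6, by rw [h5]; exact h3⟩ }⟩

theorem IsPlanar.exists_isPlanarRotation {V : Type*} {G : SimpleGraph V} [Fintype V]
    [DecidableEq V] [DecidableRel G.Adj] (h : IsPlanar G) :
    ∃ (o : G.edgeSet → G.Dart) (σ : Equiv.Perm G.Dart), IsPlanarRotation o σ := by
  obtain ⟨D⟩ := h
  have ho : ∀ e : G.edgeSet, ∃ d : G.Dart, d.edge = e := by
    rintro ⟨e, he⟩
    induction e with | _ u v => exact ⟨⟨(u, v), he⟩, rfl⟩
  choose o ho using ho
  exact ⟨o, D.exists_isPlanarRotation o ho⟩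

theorem card_edgeFinset_induce_compl_add_degree {V : Type*} [Fintype V] [DecidableEq V]
    (G : SimpleGraph V) [DecidableRel G.Adj] (v : V) :
    (G.induce {v}ᶜ).edgeFinset.card + G.degree v = G.edgeFinset.card := by
  rw [G.card_edgeFinset_induce_compl_singleton, G.card_edgeFinset_deleteIncidenceSet]
  exact Nat.sub_add_cancel (G.degree_le_card_edgeFinset v)

/-- Deleting a vertex of degree at most 1 lowers the bound by 3 but the edge count by at most 1. So
such a vertex never obstructs the induction, and it excludes equality. -/
theorem IsPlanar.card_edgeFinset_add_six_le_and {n : ℕ} (hn : 3 ≤ n) :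
    ∀ {V : Type*} [Fintype V] [DecidableEq V] {G : SimpleGraph V} [DecidableRel G.Adj],
      Fintype.card V = n → IsPlanar G → G.edgeFinset.card + 6 ≤ 3 * n ∧
        (G.edgeFinset.card + 6 = 3 * n → ∀ v, 2 ≤ G.degree v) := by
  induction n, hn using Nat.le_induction with
  | base =>
    intro V _ _ G _ hV hG
    have h1 := G.card_edgeFinset_le_card_choose_two
    rw [hV] at h1
    have h1 : G.edgeFinset.card ≤ 3 := h1
    refine ⟨by omega, fun h v => ?_⟩
    have h2 := (G.induce {v}ᶜ).card_edgeFinset_le_card_choose_two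
    have h3 := card_edgeFinset_induce_compl_add_degree G v
    have h4 : Fintype.card ({v}ᶜ : Set V) = 2 := by
      rw [Fintype.card_compl_set, hV]; simp
    rw [h4] at h2
    have h2 : (G.induce {v}ᶜ).edgeFinset.card ≤ 1 := h2
    omega
  | succ n hn ih =>
    intro V _ _ G _ hV hG
    by_cases hdeg : ∀ v, 2 ≤ G.degree v
    · refine ⟨?_, fun _ => hdeg⟩
      obtain ⟨o, σ, h⟩ := hG.exists_isPlanarRotation
      obtain ⟨v⟩ : Nonempty V := Fintype.card_pos_iff.1 (by omega)
      obtain ⟨w, hw⟩ := (G.degree_pos_iff_exists_adj v).1 (by have := hdeg v; omega)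
      have : Nonempty G.Dart := ⟨⟨(v, w), hw⟩⟩
      rw [← hV]
      exact (h.card_edgeFinset_add_six_le hdeg).1
    · push Not at hdeg
      obtain ⟨v, hv⟩ := hdeg
      have h3 := card_edgeFinset_induce_compl_add_degree G v
      have h4 : Fintype.card ({v}ᶜ : Set V) = n := by
        rw [Fintype.card_compl_set, hV]; simp
      have h5 := (ih h4 (hG.induce {v}ᶜ)).1
      exact ⟨by omega, by omega⟩

/-- A rotation at every vertex of `G`, all of whose faces are triangles. -/
def IsTriangulation {V : Type*} {G : SimpleGraph V} [Fintype V] [DecidableRel G.Adj]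
    (σ : Equiv.Perm G.Dart) : Prop :=
  (∀ d, (σ d).fst = d.fst) ∧ (∀ d (k : ℕ), (σ ^ k) d = d ↔ G.degree d.fst ∣ k) ∧
    ∀ d, facePerm σ (facePerm σ (facePerm σ d)) = d

theorem IsPlanar.exists_isTriangulation {V : Type*} [Fintype V] [DecidableEq V]
    {G : SimpleGraph V} [DecidableRel G.Adj] (hG : IsPlanar G) (hV : 3 ≤ Fintype.card V)
    (hE : G.edgeFinset.card + 6 = 3 * Fintype.card V) :
    ∃ σ : Equiv.Perm G.Dart, IsTriangulation σ := by
  have hdeg := (IsPlanar.card_edgeFinset_add_six_le_and hV rfl hG).2 hE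
  obtain ⟨o, σ, h⟩ := hG.exists_isPlanarRotation
  obtain ⟨v⟩ : Nonempty V := Fintype.card_pos_iff.1 (by omega)
  obtain ⟨w, hw⟩ := (G.degree_pos_iff_exists_adj v).1 (by have := hdeg v; omega)
  have : Nonempty G.Dart := ⟨⟨(v, w), hw⟩⟩
  exact ⟨σ, h.1, h.2.1, (h.card_edgeFinset_add_six_le hdeg).2 hE⟩

/-! ### Degrees and fans in triangulations -/

section Combinatorics
variable {V : Type*} {G : SimpleGraph V} [Fintype V] [DecidableRel G.Adj]

/-- The third dart of the face through `d` and `(σ d).symm` runs from `d.snd` to `(σ d).snd`. -/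
theorem IsTriangulation.adj {σ : Equiv.Perm G.Dart} (h : IsTriangulation σ) (d : G.Dart) :
    G.Adj d.snd (σ d).snd := by
  have h1 := h.2.2 d
  have h2 : (facePerm σ (facePerm σ d)).snd = (σ d).snd := h.1 (facePerm σ d)
  have h3 : (facePerm σ (facePerm σ (facePerm σ d))).snd = (facePerm σ (facePerm σ d)).fst :=
    h.1 _
  rw [h1] at h3
  rw [h3, ← h2]
  exact (facePerm σ (facePerm σ d)).adj

theorem IsTriangulation.fst_pow {σ : Equiv.Perm G.Dart} (h : IsTriangulation σ) (d : G.Dart)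
    (k : ℕ) : ((σ ^ k) d).fst = d.fst := by
  induction k with
  | zero => rfl
  | succ k ih => rw [pow_succ', Equiv.Perm.mul_apply, h.1, ih]

theorem IsTriangulation.pow_eq_pow {σ : Equiv.Perm G.Dart} (h : IsTriangulation σ) {d : G.Dart}
    {i j : ℕ} (hij : i ≤ j) (he : (σ ^ i) d = (σ ^ j) d) : G.degree d.fst ∣ j - i := by
  obtain ⟨k, rfl⟩ := Nat.exists_eq_add_of_le hij
  rw [pow_add, Equiv.Perm.mul_apply] at he
  rw [add_tsub_cancel_left]
  exact (h.2.1 d k).1 ((σ ^ i).injective he.symm)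

/-- In a triangulation, a vertex of degree more than `k` is the centre of a `k`-fan. -/
theorem IsTriangulation.fanGraph_isContained {σ : Equiv.Perm G.Dart} (h : IsTriangulation σ)
    {k : ℕ} {v : V} (hv : k < G.degree v) : (fanGraph k).IsContained G := by
  obtain ⟨w, hw⟩ := (G.degree_pos_iff_exists_adj v).1 (by omega)
  let d : G.Dart := ⟨(v, w), hw⟩
  have hfst : ∀ i, ((σ ^ i) d).fst = v := h.fst_pow d
  have hadj : ∀ i, G.Adj v ((σ ^ i) d).snd := fun i => by
    have := ((σ ^ i) d).adj
    rwa [hfst] at this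
  have hstep : ∀ i, G.Adj ((σ ^ i) d).snd ((σ ^ (i + 1)) d).snd := fun i => by
    rw [pow_succ', Equiv.Perm.mul_apply]
    exact h.adj _
  have hinj : ∀ i j : ℕ, i ≤ k → j ≤ k → ((σ ^ i) d).snd = ((σ ^ j) d).snd → i = j := by
    have key : ∀ i j : ℕ, i ≤ j → j ≤ k → ((σ ^ i) d).snd = ((σ ^ j) d).snd → i = j :=
      fun i j hij hj he => by
        have h1 : (σ ^ i) d = (σ ^ j) d :=
          SimpleGraph.Dart.ext _ _ (Prod.ext ((hfst i).trans (hfst j).symm) he)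
        have h2 := h.pow_eq_pow hij h1
        have h3 : j - i = 0 := Nat.eq_zero_of_dvd_of_lt h2 (by
          change j - i < G.degree v; omega)
        omega
    intro i j hi hj he
    rcases le_total i j with hij | hij
    · exact key i j hij hj he
    · exact (key j i hij hi he.symm).symm
  let f : Fin 1 ⊕ Fin (k + 1) → V := Sum.elim (fun _ => v) fun i => ((σ ^ (i : ℕ)) d).snd
  have hf : ∀ {a b}, (fanGraph k).Adj a b → G.Adj (f a) (f b) := by
    rintro (a | a) (b | b) hab
    · simp [fanGraph, graphJoin, Subsingleton.elim a b] at hab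
    · exact hadj b
    · exact (hadj a).symm
    · have h1 : (SimpleGraph.pathGraph (k + 1)).Adj a b := by
        simpa [fanGraph, graphJoin] using hab
      rcases SimpleGraph.pathGraph_adj.1 h1 with h2 | h2
      · have := hstep a
        rwa [h2] at this
      · have := hstep b
        rw [h2] at this
        exact this.symm
  refine ⟨⟨⟨f, hf⟩, ?_⟩⟩
  rintro (a | a) (b | b) hab
  · rw [Subsingleton.elim a b]
  · exact absurd hab (hadj b).ne
  · exact absurd hab.symm (hadj a).ne
  · exact congrArg Sum.inr (Fin.ext (hinj a b (by omega) (by omega) hab))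

theorem fanGraph_free_of_degree_le {k : ℕ} (h : ∀ v, G.degree v ≤ k) : (fanGraph k).Free G := by
  classical
  rintro ⟨f⟩
  have hadj : ∀ i, G.Adj (f (.inl 0)) (f (.inr i)) := fun i =>
    f.toHom.map_adj (by simp [fanGraph, graphJoin])
  have h1 : (Finset.univ.image fun i : Fin (k + 1) => f (.inr i)).card = k + 1 := by
    have hinj : Function.Injective fun i : Fin (k + 1) => f (.inr i) :=
      fun i j hij => Sum.inr_injective (f.injective' hij)
    rw [Finset.card_image_of_injective _ hinj, Finset.card_univ, Fintype.card_fin]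
  have h2 : (Finset.univ.image fun i : Fin (k + 1) => f (.inr i)) ⊆
      G.neighborFinset (f (.inl 0)) := fun x hx => by
    obtain ⟨i, -, rfl⟩ := Finset.mem_image.1 hx
    exact (G.mem_neighborFinset _ _).2 (hadj i)
  have h3 := Finset.card_le_card h2
  rw [h1, G.card_neighborFinset_eq_degree] at h3
  have := h (f (.inl 0))
  omega

/-- The rotation of a triangulation, as a function on vertices: `nx v w` is the neighbour of `v`
next to `w`. -/
structure IsNext (G : SimpleGraph V) [DecidableRel G.Adj] (nx : V → V → V) : Prop where
  adj {v w} : G.Adj v w → G.Adj v (nx v w)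
  left {v w} : G.Adj v w → nx (nx v w) v = w
  right {v w} : G.Adj v w → nx w (nx v w) = v
  iterate {v w} (k : ℕ) : G.Adj v w → ((nx v)^[k] w = w ↔ G.degree v ∣ k)

theorem IsTriangulation.exists_isNext [DecidableEq V] {σ : Equiv.Perm G.Dart}
    (h : IsTriangulation σ) : ∃ nx, IsNext G nx := by
  -- The value `w` at non-adjacent pairs is arbitrary; every law of `IsNext` assumes adjacency.
  let nx : V → V → V := fun v w => if hvw : G.Adj v w then (σ ⟨(v, w), hvw⟩).snd else w
  have hnx : ∀ d : G.Dart, nx d.fst d.snd = (σ d).snd := fun d => by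
    simp only [nx, dif_pos d.adj]
  have hface : ∀ d : G.Dart, nx (σ d).snd d.fst = d.snd := fun d => by
    have h1 := hnx (facePerm σ d)
    have h3 : (facePerm σ (facePerm σ (facePerm σ d))).snd = (facePerm σ (facePerm σ d)).fst :=
      h.1 _
    rw [h.2.2 d] at h3
    have h4 : (facePerm σ d).snd = d.fst := h.1 d
    rw [h4] at h1
    exact h1.trans h3.symm
  have hit : ∀ (k : ℕ) (d : G.Dart), (nx d.fst)^[k] d.snd = ((σ ^ k) d).snd := fun k d => by
    induction k with
    | zero => rfl
    | succ k ih =>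
      rw [Function.iterate_succ_apply', ih, pow_succ', Equiv.Perm.mul_apply, ← hnx, h.fst_pow]
  have hleft : ∀ {v w}, G.Adj v w → nx (nx v w) v = w := fun {v w} hvw => by
    rw [hnx ⟨(v, w), hvw⟩]
    exact hface ⟨(v, w), hvw⟩
  have hadj : ∀ {v w}, G.Adj v w → G.Adj v (nx v w) := fun {v w} hvw => by
    rw [hnx ⟨(v, w), hvw⟩]
    have := (σ ⟨(v, w), hvw⟩).adj
    rwa [h.1] at this
  refine ⟨nx, hadj, hleft, fun {v w} hvw => ?_, fun {v w} k hvw => ?_⟩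
  · have h1 := hleft (hadj hvw).symm
    rwa [hleft hvw] at h1
  · rw [hit k ⟨(v, w), hvw⟩, ← h.2.1 ⟨(v, w), hvw⟩ k]
    refine ⟨fun he => SimpleGraph.Dart.ext _ _ (Prod.ext (h.fst_pow _ k) he), fun he => by rw [he]⟩

namespace IsNext
variable {nx : V → V → V}

theorem injective (h : IsNext G nx) {v w w' : V} (hw : G.Adj v w) (hw' : G.Adj v w')
    (he : nx v w = nx v w') : w = w' := by
  rw [← h.left hw, he, h.left hw']

theorem adj_iterate (h : IsNext G nx) {v w : V} (hw : G.Adj v w) (k : ℕ) :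
    G.Adj v ((nx v)^[k] w) := by
  induction k with
  | zero => exact hw
  | succ k ih => rw [Function.iterate_succ_apply']; exact h.adj ih

theorem iterate_ne (h : IsNext G nx) {v w : V} (hw : G.Adj v w) {i j : ℕ} (hij : i < j)
    (hj : j < i + G.degree v) : (nx v)^[i] w ≠ (nx v)^[j] w := fun he => by
  obtain ⟨k, rfl⟩ := Nat.exists_eq_add_of_le hij.le
  rw [add_comm, Function.iterate_add_apply] at he
  have := (h.iterate k (h.adj_iterate hw i)).1 he.symm
  have := Nat.le_of_dvd (by omega) this
  omega

theorem exists_iterate_eq [DecidableEq V] (h : IsNext G nx) {v w w' : V} (hw : G.Adj v w)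
    (hw' : G.Adj v w') : ∃ k < G.degree v, (nx v)^[k] w = w' := by
  have hinj : Set.InjOn (fun k => (nx v)^[k] w) (Finset.range (G.degree v)) := by
    intro i hi j hj he
    simp only [Finset.coe_range, Set.mem_Iio] at hi hj
    rcases lt_trichotomy i j with hij | hij | hij
    · exact absurd he (h.iterate_ne hw hij (by omega))
    · exact hij
    · exact absurd he.symm (h.iterate_ne hw hij (by omega))
  have h1 : (Finset.range (G.degree v)).image (fun k => (nx v)^[k] w) = G.neighborFinset v := by
    refine Finset.eq_of_subset_of_card_le (fun x hx => ?_) ?_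
    · obtain ⟨k, -, rfl⟩ := Finset.mem_image.1 hx
      exact (G.mem_neighborFinset _ _).2 (h.adj_iterate hw k)
    · rw [Finset.card_image_of_injOn hinj, G.card_neighborFinset_eq_degree, Finset.card_range]
  have h2 := (G.mem_neighborFinset v w').2 hw'
  rw [← h1] at h2
  obtain ⟨k, hk, he⟩ := Finset.mem_image.1 h2
  exact ⟨k, Finset.mem_range.1 hk, he⟩

/-- No triangulation has one vertex of degree four and all others of degree five. -/
theorem not_degree_four_five [DecidableEq V] (h : IsNext G nx) {v : V} (hv : G.degree v = 4)
    (hdeg : ∀ w, w ≠ v → G.degree w = 5) : False := by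
  let s := nx v
  have hs : ∀ w, G.Adj v w → G.Adj v (s w) := fun w hw => h.adj hw
  have hs4 : ∀ w, G.Adj v w → s (s (s (s w))) = w := fun w hw => (h.iterate 4 hw).2 hv.dvd
  let x : V → V := fun w => nx w (s (s (s w)))
  -- The neighbours of `w` are, in this order, `s w`, `v`, the predecessor of `w`, `x w`, `x (s w)`.
  have c1 : ∀ w, G.Adj v w → nx w (s w) = v := fun w hw => h.right hw
  have c2 : ∀ w, G.Adj v w → nx w v = s (s (s w)) := fun w hw => by
    have := h.left (hs _ (hs _ (hs _ hw)))
    have h4 : nx v (nx v (nx v (nx v w))) = w := hs4 w hw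
    rwa [h4] at this
  have a0 : ∀ w, G.Adj v w → G.Adj w (s w) := fun w hw => by
    have := h.adj (hs w hw).symm
    rw [h.left hw] at this
    exact this.symm
  have a1 : ∀ w, G.Adj v w → G.Adj w (s (s (s w))) := fun w hw => by
    rw [← c2 w hw]; exact h.adj hw.symm
  have a2 : ∀ w, G.Adj v w → G.Adj w (x w) := fun w hw => h.adj (a1 w hw)
  have xs : ∀ w, G.Adj v w → x (s w) = nx (s w) w := fun w hw => by
    simp only [x]; rw [hs4 w hw]
  have a3 : ∀ w, G.Adj v w → G.Adj w (x (s w)) := fun w hw => by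
    have h1 := h.adj (h.adj (a0 w hw).symm).symm
    rw [h.left (a0 w hw).symm] at h1
    rw [xs w hw]
    exact h1.symm
  have c4 : ∀ w, G.Adj v w → nx w (x (s w)) = s w := fun w hw => by
    rw [xs w hw]; exact h.right (a0 w hw).symm
  have hw5 : ∀ w, G.Adj v w → G.degree w = 5 := fun w hw => hdeg w hw.ne'
  -- The rotation at `w` closes after five steps, so the successors of `nx w (x w)` and of `x (s w)`
  -- are both `s w`.
  have c3 : ∀ w, G.Adj v w → nx w (x w) = x (s w) := fun w hw => by
    refine h.injective (h.adj (a2 w hw)) (a3 w hw) ?_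
    rw [c4 w hw]
    have h5 := (h.iterate 5 (a0 w hw)).2 (hw5 w hw).dvd
    simpa only [Function.iterate_succ_apply, Function.iterate_zero_apply, c1 w hw, c2 w hw] using h5
  have it2 : ∀ w, G.Adj v w → (nx w)^[2] (s w) = s (s (s w)) := fun w hw => by
    simp only [Function.iterate_succ_apply, Function.iterate_zero_apply, c1 w hw, c2 w hw]
  have it3 : ∀ w, G.Adj v w → (nx w)^[3] (s w) = x w := fun w hw => by
    rw [Function.iterate_succ_apply', it2 w hw]
  have it4 : ∀ w, G.Adj v w → (nx w)^[4] (s w) = x (s w) := fun w hw => by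
    rw [Function.iterate_succ_apply', it3 w hw, c3 w hw]
  have xv : ∀ w, G.Adj v w → x w ≠ v := fun w hw => by
    rw [← it3 w hw, ← c1 w hw]
    exact (h.iterate_ne (a0 w hw) (i := 1) (j := 3) (by omega) (by rw [hw5 w hw]; omega)).symm
  have x5 : ∀ w, G.Adj v w → G.degree (x w) = 5 := fun w hw => hdeg _ (xv w hw)
  have b0 : ∀ w, G.Adj v w → G.Adj (x (s w)) (x w) := fun w hw => by
    have h1 := h.left (a2 w hw)
    rw [c3 w hw] at h1
    have := h.adj (a3 w hw).symm
    rwa [h1] at this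
  have d1 : ∀ w, G.Adj v w → nx (x (s w)) w = x w := fun w hw => by
    have := h.left (a2 w hw)
    rwa [c3 w hw] at this
  have d2 : ∀ w, G.Adj v w → nx (x (s w)) (s w) = w := fun w hw => by
    have := h.left (a0 w hw).symm
    rwa [← xs w hw] at this
  have d3 : ∀ w, G.Adj v w → nx (x (s w)) (x (s (s w))) = s w := fun w hw => by
    have := h.right (a2 _ (hs w hw))
    rwa [c3 _ (hs w hw)] at this
  -- The remaining neighbour of `x (s w)`, besides `w`, `s w`, `x w` and `x (s (s w))`. It turns out
  -- to be the same vertex for all four `w`, with the four vertices `x w` as a closed cycle around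
  -- it.
  let y : V → V := fun w => nx (x (s w)) (x w)
  have e1 : ∀ w, G.Adj v w → nx (x (s w)) (y w) = x (s (s w)) := fun w hw => by
    have h5 := (h.iterate 5 (b0 _ (hs w hw)).symm).2 (x5 _ (hs w hw)).dvd
    simpa only [Function.iterate_succ_apply, Function.iterate_zero_apply, d3 w hw, d2 w hw,
      d1 w hw] using h5
  have f1 : ∀ w, G.Adj v w → nx (x w) (y w) = x (s w) := fun w hw => h.right (b0 w hw)
  have f2 : ∀ w, G.Adj v w → nx (y w) (x (s w)) = x w := fun w hw => h.left (b0 w hw)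
  have f0 : ∀ w, G.Adj v w → G.Adj (x (s w)) (y w) := fun w hw => h.adj (b0 w hw)
  have g1 : ∀ w, G.Adj v w → G.Adj (x w) (y w) := fun w hw => by
    have := h.adj (f0 w hw).symm
    rw [f2 w hw] at this
    exact this.symm
  have yc : ∀ w, G.Adj v w → y (s w) = y w := fun w hw =>
    h.injective (g1 _ (hs w hw)) (f0 w hw) ((f1 _ (hs w hw)).trans (e1 w hw).symm)
  obtain ⟨a, ha⟩ := (G.degree_pos_iff_exists_adj v).1 (by omega)
  have hb := hs a ha
  have hc := hs _ hb
  have hd := hs _ hc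
  have y1 := yc a ha
  have y2 := (yc _ hb).trans y1
  have y3 := (yc _ hc).trans y2
  have k0 := f2 a ha
  have k1 := f2 _ hb
  have k2 := f2 _ hc
  have k3 := f2 _ hd
  rw [y1] at k1
  rw [y2] at k2
  rw [y3, hs4 a ha] at k3
  -- The rotation at `y a` returns after four steps, so its degree divides 4; hence it cannot be 5.
  have hdvd := (h.iterate 4 (g1 a ha).symm).1 (by
    simp only [Function.iterate_succ_apply, Function.iterate_zero_apply, k3, k2, k1, k0])
  -- If `y a = v`, then `x a` is one of the four neighbours of `v`. Each option makes two neighbours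
  -- of `a`, or of its predecessor, coincide, or makes `x a` equal to `a`.
  by_cases hyv : y a = v
  · have hx : G.Adj v (x a) := hyv ▸ (g1 a ha).symm
    obtain ⟨k, hk, he⟩ := h.exists_iterate_eq ha hx
    rw [hv] at hk
    have hxx : x (s (s (s (s a)))) = x a := by rw [hs4 a ha]
    interval_cases k
    · exact (a2 a ha).ne he
    · have := h.iterate_ne (a0 a ha) (i := 0) (j := 3) (by omega) (by rw [hw5 a ha]; omega)
      rw [it3 a ha] at this
      exact this he
    · have := h.iterate_ne (a0 _ hd) (i := 2) (j := 4) (by omega) (by rw [hw5 _ hd]; omega)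
      rw [it4 _ hd, it2 _ hd, hxx, hs4 _ hc] at this
      exact this he
    · have := h.iterate_ne (a0 a ha) (i := 2) (j := 3) (by omega) (by rw [hw5 a ha]; omega)
      rw [it3 a ha, it2 a ha] at this
      exact this he
  · rw [hdeg _ hyv] at hdvd
    omega

end IsNext

/-- The degree sum is 54 = 5 · 11 - 1, so the deficits `5 - G.degree v` add up to 1: a single vertex
has degree 4. -/
theorem IsTriangulation.false_of_card_eq_eleven [DecidableEq V] {σ : Equiv.Perm G.Dart}
    (h : IsTriangulation σ) (hV : Fintype.card V = 11) (hE : G.edgeFinset.card = 27)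
    (hdeg : ∀ v, G.degree v ≤ 5) : False := by
  obtain ⟨nx, hnx⟩ := h.exists_isNext
  have h1 := G.sum_degrees_eq_twice_card_edges
  have h2 : ∑ v, (5 - G.degree v) + ∑ v, G.degree v = 55 := by
    rw [← Finset.sum_add_distrib]
    simp only [Nat.sub_add_cancel (hdeg _), Finset.sum_const, Finset.card_univ, hV, smul_eq_mul]
  have h3 : ∑ v, (5 - G.degree v) = 1 := by omega
  obtain ⟨v, -, hv⟩ := Finset.exists_ne_zero_of_sum_ne_zero (h3.trans_ne one_ne_zero)
  have h4 := Finset.add_sum_erase Finset.univ (fun v => 5 - G.degree v) (Finset.mem_univ v)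
  have h5 : ∑ w ∈ Finset.univ.erase v, (5 - G.degree w) = 0 := by omega
  have h6 := hdeg v
  refine hnx.not_degree_four_five (v := v) (by omega) fun w hw => ?_
  have h7 := Finset.sum_eq_zero_iff.1 h5 w (Finset.mem_erase.2 ⟨hw, Finset.mem_univ _⟩)
  have h8 := hdeg w
  omega

end Combinatorics

/-! ### Certifying straight line drawings with integer coordinates -/

section Drawing

/-- Twice the signed area of the triangle `a b c`. -/
def orientation {R : Type*} [Ring R] (a b c : R × R) : R :=
  (b.1 - a.1) * (c.2 - a.2) - (b.2 - a.2) * (c.1 - a.1)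

theorem orientation_lineMap (a b c d : ℝ × ℝ) (t : ℝ) :
    orientation a b (c + t • (d - c)) = (1 - t) * orientation a b c + t * orientation a b d := by
  simp only [orientation, Prod.fst_add, Prod.snd_add, Prod.smul_fst, Prod.smul_snd, Prod.fst_sub,
    Prod.snd_sub, smul_eq_mul]
  ring

theorem orientation_eq_zero_of_mem_segment {a b x : ℝ × ℝ} (hx : x ∈ segment ℝ a b) :
    orientation a b x = 0 := by
  rw [segment_eq_image'] at hx
  obtain ⟨t, -, rfl⟩ := hx
  rw [orientation_lineMap]
  simp only [orientation]; ring

/-- Both ends of the second segment lie strictly on one side of the line through the first. -/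
theorem disjoint_segment_of_orientation {a b c d : ℝ × ℝ}
    (h : 0 < orientation a b c * orientation a b d) :
    Disjoint (segment ℝ a b) (segment ℝ c d) := by
  rw [Set.disjoint_left]
  intro x hx hx'
  have h0 := orientation_eq_zero_of_mem_segment hx
  rw [segment_eq_image'] at hx'
  obtain ⟨t, ⟨ht0, ht1⟩, rfl⟩ := hx'
  rw [orientation_lineMap] at h0
  rcases pos_and_pos_or_neg_and_neg_of_mul_pos h with ⟨h1, h2⟩ | ⟨h1, h2⟩
  · rcases ht0.eq_or_lt with rfl | ht0
    · simp at h0; linarith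
    · nlinarith [mul_pos ht0 h2, mul_nonneg (sub_nonneg.2 ht1) h1.le]
  · rcases ht0.eq_or_lt with rfl | ht0
    · simp at h0; linarith
    · nlinarith [mul_neg_of_pos_of_neg ht0 h2,
        mul_nonpos_of_nonneg_of_nonpos (sub_nonneg.2 ht1) h1.le]

theorem eq_of_mem_segment_of_orientation_ne_zero {a b c x : ℝ × ℝ} (h : orientation a b c ≠ 0)
    (hx : x ∈ segment ℝ a b) (hx' : x ∈ segment ℝ a c) : x = a := by
  have h0 := orientation_eq_zero_of_mem_segment hx
  rw [segment_eq_image'] at hx'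
  obtain ⟨t, -, rfl⟩ := hx'
  rw [orientation_lineMap] at h0
  have h1 : orientation a b a = 0 := by simp [orientation]
  rw [h1, mul_zero, zero_add] at h0
  have ht := (mul_eq_zero.1 h0).resolve_right h
  simp [ht]

/-- The graph on `Fin n` with the listed edges. -/
def listGraph {n : ℕ} (E : List (Fin n × Fin n)) : SimpleGraph (Fin n) where
  Adj u v := u ≠ v ∧ ((u, v) ∈ E ∨ (v, u) ∈ E)
  symm := ⟨fun _ _ h => ⟨h.1.symm, h.2.symm⟩⟩
  loopless := ⟨fun _ h => h.1 rfl⟩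

instance {n : ℕ} (E : List (Fin n × Fin n)) : DecidableRel (listGraph E).Adj :=
  fun _ _ => inferInstanceAs (Decidable (_ ∧ _))

/-- The points `p` give a straight line drawing of the graph with edge list `E`. -/
def IsStraightDrawing {n : ℕ} (E : List (Fin n × Fin n)) (p : Fin n → ℤ × ℤ) : Prop :=
  (∀ e ∈ E, ∀ w, w ≠ e.1 → w ≠ e.2 → orientation (p e.1) (p e.2) (p w) ≠ 0) ∧
  (∀ e ∈ E, ∀ f ∈ E, e.1 ≠ f.1 → e.1 ≠ f.2 → e.2 ≠ f.1 → e.2 ≠ f.2 →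
    0 < orientation (p e.1) (p e.2) (p f.1) * orientation (p e.1) (p e.2) (p f.2) ∨
    0 < orientation (p f.1) (p f.2) (p e.1) * orientation (p f.1) (p f.2) (p e.2)) ∧
  ∀ u v, p u = p v → u = v

set_option synthInstance.maxSize 1000 in
set_option synthInstance.maxHeartbeats 400000 in
instance {n : ℕ} (E : List (Fin n × Fin n)) (p : Fin n → ℤ × ℤ) :
    Decidable (IsStraightDrawing E p) :=
  inferInstanceAs (Decidable (_ ∧ _ ∧ _))

theorem IsStraightDrawing.isPlanar {n : ℕ} {E : List (Fin n × Fin n)} {p : Fin n → ℤ × ℤ}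
    (h : IsStraightDrawing E p) : IsPlanar (listGraph E) := by
  obtain ⟨h1, h2, h3⟩ := h
  let P : Fin n → ℝ × ℝ := fun v => ((p v).1, (p v).2)
  have hori : ∀ u v w, orientation (P u) (P v) (P w) = (orientation (p u) (p v) (p w) : ℤ) :=
    fun u v w => by simp only [orientation, P]; push_cast; ring
  have hP : Function.Injective P := fun u v huv => h3 u v <| by
    have e1 := congrArg Prod.fst huv
    have e2 := congrArg Prod.snd huv
    simp only [P] at e1 e2
    exact Prod.ext (by exact_mod_cast e1) (by exact_mod_cast e2)
  let arc : Sym2 (Fin n) → Set (ℝ × ℝ) :=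
    Sym2.lift ⟨fun u v => segment ℝ (P u) (P v), fun u v => segment_symm ℝ _ _⟩
  have harc : ∀ u v, arc s(u, v) = segment ℝ (P u) (P v) := fun u v => rfl
  have hedge : ∀ e ∈ (listGraph E).edgeSet, ∃ u v, (u, v) ∈ E ∧ e = s(u, v) ∧ u ≠ v := by
    intro e he
    induction e with | _ u v =>
    rcases he with ⟨hne, h | h⟩
    · exact ⟨u, v, h, rfl, hne⟩
    · exact ⟨v, u, h, Sym2.eq_swap, hne.symm⟩
  have hvert : ∀ u v w, (u, v) ∈ E → P w ∈ segment ℝ (P u) (P v) → w = u ∨ w = v := by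
    intro u v w huv hw
    by_contra! hne
    have e1 := orientation_eq_zero_of_mem_segment hw
    rw [hori] at e1
    exact h1 _ huv w hne.1 hne.2 (by exact_mod_cast e1)
  have hshare : ∀ u v w x, orientation (p u) (p v) (p w) ≠ 0 → x ∈ segment ℝ (P u) (P v) →
      x ∈ segment ℝ (P u) (P w) → P u = x := fun u v w x ho hx hx' =>
    (eq_of_mem_segment_of_orientation_ne_zero (by rw [hori]; exact_mod_cast ho) hx hx').symm
  have hswap : ∀ u v w, orientation (p v) (p u) (p w) = -orientation (p u) (p v) (p w) :=
    fun u v w => by simp only [orientation]; ring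
  refine ⟨{ pt := P, arc := arc, pt_injective := hP, isPolygonalArc := ?_,
            mem_of_pt_mem_arc := ?_, eq_pt_of_mem_arc := ?_ }⟩
  · intro u v huv
    exact .single _ _ (hP.ne huv.1)
  · intro e he w hw
    obtain ⟨u, v, huv, rfl, -⟩ := hedge e he
    exact Sym2.mem_iff.2 (hvert u v w huv hw)
  · rintro e he f hf hne x ⟨hx, hx'⟩
    obtain ⟨u, v, huv, rfl, huv'⟩ := hedge e he
    obtain ⟨a, b, hab, rfl, hab'⟩ := hedge f hf
    rw [harc] at hx hx'
    simp only [Sym2.mem_iff]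
    by_cases e1 : u = a
    · subst e1
      have hvb : b ≠ v := by rintro rfl; exact hne rfl
      exact ⟨u, .inl rfl, .inl rfl, hshare u v b x (h1 _ huv b hab'.symm hvb) hx hx'⟩
    by_cases e2 : u = b
    · subst e2
      have hva : a ≠ v := by rintro rfl; exact hne Sym2.eq_swap
      rw [segment_symm] at hx'
      exact ⟨u, .inl rfl, .inr rfl, hshare u v a x (h1 _ huv a hab' hva) hx hx'⟩
    by_cases e3 : v = a
    · subst e3
      rw [segment_symm] at hx
      refine ⟨v, .inr rfl, .inl rfl, hshare v u b x ?_ hx hx'⟩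
      rw [hswap]
      exact neg_ne_zero.2 (h1 _ huv b (Ne.symm e2) hab'.symm)
    by_cases e4 : v = b
    · subst e4
      rw [segment_symm] at hx hx'
      refine ⟨v, .inr rfl, .inr rfl, hshare v u a x ?_ hx hx'⟩
      rw [hswap]
      exact neg_ne_zero.2 (h1 _ huv a (Ne.symm e1) hab')
    exfalso
    rcases h2 _ huv _ hab e1 e2 e3 e4 with h | h
    · refine Set.disjoint_left.1 (disjoint_segment_of_orientation ?_) hx hx'
      rw [hori, hori]; exact_mod_cast h
    · refine Set.disjoint_left.1 (disjoint_segment_of_orientation ?_) hx' hx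
      rw [hori, hori]; exact_mod_cast h

end Drawing

/-! ### The planar Turán numbers of fans -/

theorem fanGraph_ne_bot (k : ℕ) : fanGraph k ≠ ⊥ := fun h => by
  have h1 : (fanGraph k).Adj (.inl 0) (.inr 0) := by simp [fanGraph, graphJoin]
  rw [h] at h1
  exact h1

theorem ncard_edgeSet_eq_card_edgeFinset {V : Type*} [Fintype V] [DecidableEq V]
    (G : SimpleGraph V) [DecidableRel G.Adj] : G.edgeSet.ncard = G.edgeFinset.card :=
  Set.ncard_eq_toFinset_card' _

/-- Reduces each extremal example to finite checks: integer orientations for planarity, and degrees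
for fan-freeness and the edge count. -/
theorem planarTuranNumber_fanGraph_eq {n k : ℕ} (hn : 3 ≤ n) {E : List (Fin n × Fin n)}
    {p : Fin n → ℤ × ℤ} (hp : IsStraightDrawing E p) (hdeg : ∀ v, (listGraph E).degree v ≤ k)
    (hsum : ∑ v, (listGraph E).degree v = 6 * n - 12) :
    planarTuranNumber n (fanGraph k) = 3 * n - 6 := by
  classical
  obtain ⟨⟨G, hG, -, hcard⟩, hmax⟩ := isGreatest_planarTuranNumber n _ (fanGraph_ne_bot k)
  refine le_antisymm ?_ (hmax ⟨listGraph E, hp.isPlanar, fanGraph_free_of_degree_le hdeg, ?_⟩)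
  · have h1 := (IsPlanar.card_edgeFinset_add_six_le_and hn (Fintype.card_fin n) hG).1
    rw [← hcard, ncard_edgeSet_eq_card_edgeFinset]
    omega
  · rw [SimpleGraph.sum_degrees_eq_twice_card_edges] at hsum
    rw [ncard_edgeSet_eq_card_edgeFinset]
    omega

theorem theorem3p2 (n k : ℕ) (hk : 1 ≤ k) (hk5 : k ≤ 5) (hn : k + 2 ≤ n) :
    planarTuranNumber n (fanGraph k) = 3 * n - 6 ↔
      (n, k) ∈ ({(6, 4), (7, 5), (8, 5), (9, 5), (10, 5), (12, 5)} : Set (ℕ × ℕ)) := by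
  constructor
  · intro h
    classical
    obtain ⟨⟨G, hG, hfree, hcard⟩, -⟩ := isGreatest_planarTuranNumber n _ (fanGraph_ne_bot k)
    rw [h, ncard_edgeSet_eq_card_edgeFinset] at hcard
    have hV := Fintype.card_fin n
    obtain ⟨σ, hσ⟩ := hG.exists_isTriangulation (by omega) (by omega)
    have hdeg : ∀ v, G.degree v ≤ k := fun v => by
      by_contra! hv
      exact hfree (hσ.fanGraph_isContained hv)
    have hsum := Finset.sum_le_sum fun v (_ : v ∈ Finset.univ) => hdeg v
    rw [G.sum_degrees_eq_twice_card_edges, hcard, Finset.sum_const, Finset.card_univ, hV,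
      smul_eq_mul] at hsum
    have hn11 : k = 5 → n ≠ 11 := by
      rintro rfl rfl
      exact hσ.false_of_card_eq_eleven hV hcard hdeg
    simp only [Set.mem_insert_iff, Set.mem_singleton_iff, Prod.mk.injEq]
    -- For k ≤ 3, 6n - 12 ≤ kn contradicts n ≥ k + 2; k = 4 forces n = 6, and k = 5 gives 7 ≤ n ≤
    -- 12.
    interval_cases k <;> omega
  · intro h
    simp only [Set.mem_insert_iff, Set.mem_singleton_iff, Prod.mk.injEq] at h
    -- The examples are the graphs of convex deltahedra: octahedron, pentagonal bipyramid, snub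
    -- disphenoid, triaugmented triangular prism, gyroelongated square bipyramid and icosahedron.
    rcases h with ⟨rfl, rfl⟩ | ⟨rfl, rfl⟩ | ⟨rfl, rfl⟩ | ⟨rfl, rfl⟩ | ⟨rfl, rfl⟩ | ⟨rfl, rfl⟩
    · exact planarTuranNumber_fanGraph_eq (by norm_num)
        (E := [(0, 1), (0, 2), (0, 4), (0, 5), (1, 2), (1, 3), (1, 5), (2, 3), (2, 4), (3, 4), (3, 5),
          (4, 5)])
        (p := ![(2, 1), (0, 0), (5, 0), (0, 5), (2, 2), (1, 2)])
        (by decide +kernel) (by decide +kernel) (by decide +kernel)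
    · exact planarTuranNumber_fanGraph_eq (by norm_num)
        (E := [(0, 1), (0, 4), (0, 5), (0, 6), (1, 2), (1, 5), (1, 6), (2, 3), (2, 5), (2, 6), (3, 4),
          (3, 5), (3, 6), (4, 5), (4, 6)])
        (p := ![(3, 2), (2, 3), (1, 3), (0, 0), (6, 0), (0, 6), (3, 1)])
        (by decide +kernel) (by decide +kernel) (by decide +kernel)
    · exact planarTuranNumber_fanGraph_eq (by norm_num)
        (E := [(0, 1), (0, 3), (0, 4), (0, 6), (0, 7), (1, 2), (1, 4), (1, 5), (1, 6), (2, 3), (2, 5),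
          (2, 6), (2, 7), (3, 4), (3, 5), (3, 7), (4, 5), (6, 7)])
        (p := ![(0, 0), (6, 0), (3, 2), (1, 3), (0, 6), (2, 3), (3, 1), (2, 1)])
        (by decide +kernel) (by decide +kernel) (by decide +kernel)
    · exact planarTuranNumber_fanGraph_eq (by norm_num)
        (E := [(0, 1), (0, 2), (0, 3), (0, 6), (0, 8), (1, 2), (1, 4), (1, 6), (1, 7), (2, 5), (2, 7),
          (2, 8), (3, 4), (3, 5), (3, 6), (3, 8), (4, 5), (4, 6), (4, 7), (5, 7), (5, 8)])
        (p := ![(0, 0), (11, 0), (0, 11), (2, 3), (4, 4), (2, 6), (5, 1), (4, 5), (1, 6)])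
        (by decide +kernel) (by decide +kernel) (by decide +kernel)
    · exact planarTuranNumber_fanGraph_eq (by norm_num)
        (E := [(0, 1), (0, 3), (0, 4), (0, 7), (0, 8), (1, 2), (1, 4), (1, 5), (1, 8), (2, 3), (2, 5),
          (2, 6), (2, 8), (3, 6), (3, 7), (3, 8), (4, 5), (4, 7), (4, 9), (5, 6), (5, 9), (6, 7),
          (6, 9), (7, 9)])
        (p := ![(3, 3), (4, 1), (0, 0), (1, 4), (5, 3), (11, 0), (0, 11), (3, 5), (1, 2), (5, 5)])
        (by decide +kernel) (by decide +kernel) (by decide +kernel)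
    · exact planarTuranNumber_fanGraph_eq (by norm_num)
        (E := [(0, 1), (0, 4), (0, 5), (0, 9), (0, 10), (1, 2), (1, 5), (1, 6), (1, 10), (2, 3), (2, 6),
          (2, 7), (2, 10), (3, 4), (3, 7), (3, 8), (3, 10), (4, 8), (4, 9), (4, 10), (5, 6), (5, 9),
          (5, 11), (6, 7), (6, 11), (7, 8), (7, 11), (8, 9), (8, 11), (9, 11)])
        (p := ![(3, 8), (6, 7), (8, 6), (11, 3), (0, 0), (5, 10), (8, 7), (11, 5), (21, 0), (0, 21), (5,
          4), (9, 9)])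
        (by decide +kernel) (by decide +kernel) (by decide +kernel)
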